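/- **Setting.** Label the Bell states by two bits $(a,b)$: $00=\Phi^+$, $01=\Psi^+$, $10=\Phi^-$, $11=\Psi^-$. For $0\le F\le 1$ let $\rho_F=F\,|\Phi^+\rangle\langle\Phi^+|+\frac{1-F}{3}\left(|\Phi^-\rangle\langle\Phi^-|+|\Psi^+\rangle\langle\Psi^+|+|\Psi^-\rangle\langle\Psi^-|\right)$ be the Werner state. $N$ copies of $\rho_F$ are a random string of labels $(a_1,b_1,\dots,a_N,b_N)$ with independent pairs, each equal to $00$ with probability $F$ and to each other label with probability $\frac{1-F}{3}$. The operation $\mathrm{BXOR}(i,j)$ replaces $(a_i,b_i)$ by $(a_i\oplus a_j,b_i)$ and $(a_j,b_j)$ by $(a_j,b_i\oplus b_j)$. Measuring a pair along the $z$-axis and comparing the results reveals its bit $b$ and uses up the pair. $H$ is Shannon entropy in bits. **The protocol AEPP$(a,N)$, $N=2^n$.** In a block of $N$ pairs apply $\mathrm{BXOR}(i,N)$ for all $i<N$ and measure pair $N$, which reveals $b_1\oplus\dots\oplus b_N$. If this is $0$, set the other $N-1$ pairs aside for universal hashing. If it is $1$, search for the error as follows. Given a block of $2^k$ pairs, $k\ge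 2$, known to have parity $1$, this parity having been measured on one pair of the block, measure in the same way (by BXORs onto one of its pairs) the parity of the half of the block that does not contain that pair. Set the half of parity $0$, without its measured pair ($2^{k-1}-1$ pairs), aside for universal hashing, and continue with the half of parity $1$. In a block of two pairs with parity $1$ throw the unmeasured pair away. **Universal hashing and yield.** After $L$ blocks have been processed, universal hashing on the pairs set aside consists of $r$ rounds. Each round reveals the parity of the label bits of these pairs over an independent uniformly random subset of the bits, and uses up one pair. Let $M$ be the number of pairs set aside minus $r$ (a net number, which may be negative). A rate $y$ is achievable if $r=r_L$ and decoding rules can be chosen so that, with probability tending to $1$ as $L\to\infty$, all labels of the pairs set aside are identified correctly from the announced results and $M\ge y\cdot NL$. The yield is the supremum of the achievable rates. The yield of universal hashing on $\rho_F$ is the same quantity when all pairs are set aside for hashing at once. **Theorem.** Let $p=\Pr(b_1\oplus\dots\oplus b_N=0)$ and, for $K=2,4,8,\dots,2^n$, $$S_{K-1}=H\big(a_1\oplus a_K,b_1,a_2\oplus a_K,b_2,\dots,a_{K-1}\oplus a_K,b_{K-1}\,\big|\,b_1\oplus\dots\oplus b_K=0\big),$$ the entropy of the conditional distribution of this string given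 the event $b_1\oplus\dots\oplus b_K=0$ for $K$ copies of $\rho_F$. 1. For every $n\ge 1$, $N=2^n$ and $0\le F\le 1$, the yield of AEPP$(a,N)$ on $\rho_F$ is $$Y_{\mathrm{AEPP}}=1-\frac{p}{N}\left(1+S_{N-1}\right)-\frac{1-p}{N}\left(n+1+S_{\frac N2-1}+S_{\frac N4-1}+\dots+S_3+S_1\right).$$ 2. For every $0\le F\le 1$ the yield of universal hashing on $\rho_F$ is $1-H(F,G,G,G)$, where $G=\frac{1-F}{3}$. 3. Now let $F=F_n=\frac{2^n-1}{2^n}$ and $G=G_n=\frac{1-F_n}{3}$, and let $p^*=\frac12\left(1+e^{-4/3}\right)$. Then $p\to p^*$ as $n\to\infty$. For all sufficiently large $n$, $$Y_{\mathrm{AEPP}}\;\ge\;1-H(F,G,G,G)+\frac{H(p^*,1-p^*)-p^*}{N},$$ and the limit $\lim_{n\to\infty}N\left(Y_{\mathrm{AEPP}}-(1-H(F,G,G,G))\right)$ exists and is at least $H(p^*,1-p^*)-p^*$. Moreover, for every $n$, $$1-H(F,G,G,G)+\frac{H(p^*,1-p^*)-p^*}{N}\;>\;1-H(F,G,G,G),$$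 and the right-hand side is the yield of universal hashing on $\rho_F$. -/

import Mathlib

namespace Purification

/-! ### Bell states and the Werner state -/

/-- The label `(a, b)` of a Bell state: `a` is the phase bit and `b` the amplitude bit. -/
abbrev Label : Type := ZMod 2 × ZMod 2

/-- The Bell state with label `(a, b)`, as a vector in `ℂ² ⊗ ℂ²`; a basis vector is indexed by
Alice's and Bob's bits, with `0` for `↑` and `1` for `↓`.
Thus `00 : Φ⁺`, `01 : Ψ⁺`, `10 : Φ⁻`, `11 : Ψ⁻`. -/
noncomputable def bell (c : Label) : ZMod 2 × ZMod 2 → ℂ := fun u =>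
  if u.2 = u.1 + c.2 then (-1) ^ (c.1.val * u.1.val) / (Real.sqrt 2 : ℂ) else 0

/-- The projector onto a Bell state. -/
noncomputable def bellProj (c : Label) : Matrix (ZMod 2 × ZMod 2) (ZMod 2 × ZMod 2) ℂ :=
  Matrix.vecMulVec (bell c) (star (bell c))

/-- The generalized Werner state `ρ_F`. -/
noncomputable def werner (F : ℝ) : Matrix (ZMod 2 × ZMod 2) (ZMod 2 × ZMod 2) ℂ :=
  (F : ℂ) • bellProj (0, 0) +
    (((1 - F) / 3 : ℝ) : ℂ) • (bellProj (1, 0) + bellProj (0, 1) + bellProj (1, 1))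

/-- The weight `⟨β_c| ρ |β_c⟩` of the Bell state `β_c` in a Bell-diagonal two-qubit state `ρ`. -/
noncomputable def bellWeight (ρ : Matrix (ZMod 2 × ZMod 2) (ZMod 2 × ZMod 2) ℂ) (c : Label) : ℝ :=
  (star (bell c) ⬝ᵥ (ρ.mulVec (bell c))).re

/-- The weight of the string of Bell labels `x` in the state `ρ^{⊗ι}`. -/
noncomputable def stringWeight {ι : Type} [Fintype ι]
    (ρ : Matrix (ZMod 2 × ZMod 2) (ZMod 2 × ZMod 2) ℂ) (x : ι → Label) : ℝ :=
  ∏ i, bellWeight ρ (x i)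

/-! ### Entropies -/

/-- Shannon entropy, in bits, of a finite probability vector. -/
noncomputable def shannon {α : Type} [Fintype α] (q : α → ℝ) : ℝ :=
  -∑ a, q a * Real.logb 2 (q a)

/-- The probability that `b₁ ⊕ ⋯ ⊕ b_K = 0` for the labels of `K` copies of `ρ_F`. -/
noncomputable def parityProb (F : ℝ) (K : ℕ) : ℝ :=
  ∑ x : Fin K → Label, if ∑ i, (x i).2 = 0 then stringWeight (werner F) x else 0

/-- From the labels of the pairs `1, …, m + 1` (indexed by `0, …, m`), the string
`(a₁ ⊕ a_{m+1}, b₁, …, a_m ⊕ a_{m+1}, b_m)`. -/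
def shifted {m : ℕ} (x : Fin (m + 1) → Label) : Fin m → Label := fun i =>
  ((x i.castSucc).1 + (x (Fin.last m)).1, (x i.castSucc).2)

/-- `S_{K-1} = H(a₁ ⊕ a_K, b₁, …, a_{K-1} ⊕ a_K, b_{K-1} | b₁ ⊕ ⋯ ⊕ b_K = 0)` with `K = m + 1`:
the entropy of the conditional law, given even parity, of the shifted string. -/
noncomputable def S (F : ℝ) (m : ℕ) : ℝ :=
  shannon fun v : Fin m → Label =>
    (∑ x : Fin (m + 1) → Label,
      if shifted x = v ∧ ∑ i, (x i).2 = 0 then stringWeight (werner F) x else 0) /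
      parityProb F (m + 1)

/-! ### Adaptive protocols on Bell-diagonal pairs -/

/-- `BXOR(i,j)` with source `i` and target `j`, in terms of the Bell labels. -/
def bxor {ι : Type} [DecidableEq ι] (i j : ι) (x : ι → Label) : ι → Label := fun k =>
  if k = i then ((x i).1 + (x j).1, (x i).2)
  else if k = j then ((x j).1, (x i).2 + (x j).2)
  else x k

/-- Adaptive protocols on a block of pairs indexed by `ι`. -/
inductive Protocol (ι : Type) : Type
  /-- Stop. Pairs that were not set aside for hashing are thrown away. -/
  | done : Protocol ι
  /-- Apply `BXOR` with source `i` and target `j`. -/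
  | bxor (i j : ι) (next : Protocol ι) : Protocol ι
  /-- Both parties measure pair `i` along the z-axis and compare their results, which agree iff
  the amplitude bit of the pair is `0`; they continue according to that bit. -/
  | measure (i : ι) (next : ZMod 2 → Protocol ι) : Protocol ι
  /-- Set the listed pairs aside for universal hashing, and continue with the other ones. -/
  | hash (G : List ι) (next : Protocol ι) : Protocol ι

namespace Protocol

variable {ι : Type} [DecidableEq ι]

/-- The comparison results announced when the protocol runs on the labels `x`. -/
def record : Protocol ι → (ι → Label) → List (ZMod 2)
  | done, _ => []
  | bxor i j next, x => next.record (Purification.bxor i j x)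
  | measure i next, x => (x i).2 :: (next (x i).2).record x
  | hash _ next, x => next.record x

/-- The labels of the pairs that have been set aside for hashing when the protocol has run on the
labels `x`; the value is `none` at the pairs that were measured or thrown away. -/
def kept : Protocol ι → (ι → Label) → ι → Option Label
  | done, _ => fun _ => none
  | bxor i j next, x => next.kept (Purification.bxor i j x)
  | measure i next, x => (next (x i).2).kept x
  | hash G next, x => fun i => if i ∈ G then some (x i) else next.kept x i

/-- `BXOR` from every pair in `sources` to the pair `t`, followed by a measurement of `t`. -/
def checkParity (sources : List ι) (t : ι) (next : ZMod 2 → Protocol ι) : Protocol ι :=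
  sources.foldr (fun i P => bxor i t P) (measure t next)

/-- The search for an amplitude error in a block of `2^k` pairs whose parity is known to be `1`.
The head of the list is the pair on which that parity was measured. The parity of the half that
does not contain it is measured on the pair at the other end of the list. The half with parity `0`,
without its measured pair, is set aside for hashing and the search continues in the half with
parity `1`; in a block of two pairs the remaining pair is thrown away. -/
def locate : ℕ → List ι → Protocol ι
  | 0, _ => done
  | 1, _ => done
  | k + 2, l =>
    match l.take (2 ^ (k + 1)), (l.drop (2 ^ (k + 1))).reverse with
    | t :: R, t' :: R' =>
      checkParity R' t' fun o =>
        if o = 0 then hash R' (locate (k + 1) (t :: R))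
        else hash R (locate (k + 1) (t' :: R'))
    | _, _ => done

end Protocol

/-- `AEPP(a, N)` with `N = 2^n`: the parity of the block is measured on the last pair. If it is `0`,
the other `N - 1` pairs are hashed together, otherwise the error is searched for. -/
def aepp (n : ℕ) : Protocol (Fin (2 ^ n)) :=
  match (List.finRange (2 ^ n)).reverse with
  | t :: R =>
    Protocol.checkParity R t fun o =>
      if o = 0 then Protocol.hash R Protocol.done else Protocol.locate n (t :: R)
  | [] => Protocol.done

/-- Universal hashing applied directly to the given pairs. -/
def universalHashing : Protocol (Fin 1) := Protocol.hash [0] Protocol.done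

/-! ### Universal hashing and the yield -/

section Yield

variable {ι : Type} [Fintype ι] [DecidableEq ι]

/-- The parity of the labels of one pair over the subset of its two bits selected by `s`. -/
def pairParity (s : Label) : Option Label → ZMod 2
  | some c => s.1 * c.1 + s.2 * c.2
  | none => 0

/-- The results of `r` rounds of universal hashing after `L` blocks with labels `X` have been run
through `P`: round `j` reveals the parity of the labels of all the pairs set aside, over the subset
of bits selected by `s j`. -/
def hashValue (P : Protocol ι) {L r : ℕ} (s : Fin r → Fin L → ι → Label) (X : Fin L → ι → Label) :
    Fin r → ZMod 2 := fun j =>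
  ∑ l, ∑ i, pairParity (s j l i) (P.kept (X l) i)

/-- The number of pairs set aside for hashing in `L` blocks with labels `X`. -/
def keptCount (P : Protocol ι) {L : ℕ} (X : Fin L → ι → Label) : ℕ :=
  ∑ l, (Finset.univ.filter fun i => (P.kept (X l) i).isSome).card

/-- A rule that guesses the labels of all the pairs set aside from the selected subsets, the
announced comparison results and the parities found by hashing. -/
abbrev Decoder (ι : Type) (L r : ℕ) : Type :=
  (Fin r → Fin L → ι → Label) → (Fin L → List (ZMod 2)) → (Fin r → ZMod 2) →
    Fin L → ι → Option Label

open Classical in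
/-- `L` blocks of copies of `ρ` are run through `P`, and then `r` rounds of universal hashing with
independent uniformly random subsets are made, each of which uses up one pair. This is the
probability that all the labels of the pairs set aside are identified correctly (so that local
Pauli rotations turn all the pairs that are left into `Φ⁺`) and that the number `M` of pairs set
aside less pairs used up by hashing is at least `y` times the number of initial pairs. -/
noncomputable def successProb (P : Protocol ι)
    (ρ : Matrix (ZMod 2 × ZMod 2) (ZMod 2 × ZMod 2) ℂ) (y : ℝ) (L r : ℕ) (D : Decoder ι L r) : ℝ :=
  (∑ s : Fin r → Fin L → ι → Label, ∑ X : Fin L → ι → Label,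
    if D s (fun l => P.record (X l)) (hashValue P s X) = (fun l => P.kept (X l)) ∧
        y * ((Fintype.card ι : ℝ) * (L : ℝ)) ≤ (keptCount P X : ℝ) - (r : ℝ)
    then ∏ l, stringWeight ρ (X l) else 0) /
    (Fintype.card (Fin r → Fin L → ι → Label) : ℝ)

/-- The rates `y` that are achieved by the protocol `P`, followed by universal hashing, on copies
of `ρ`: for suitable numbers of hashing rounds and suitable decoding rules, the probability of
success tends to `1` as the number of blocks tends to infinity. -/
def achievableRates (P : Protocol ι)
    (ρ : Matrix (ZMod 2 × ZMod 2) (ZMod 2 × ZMod 2) ℂ) : Set ℝ :=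
  {y | ∃ (r : ℕ → ℕ) (D : ∀ L, Decoder ι L (r L)),
    Filter.Tendsto (fun L => successProb P ρ y L (r L) (D L)) Filter.atTop (nhds 1)}

/-- The yield of the protocol `P`, followed by universal hashing, on copies of `ρ`: the optimal
asymptotic ratio of final to initial pairs. -/
noncomputable def protocolYield (P : Protocol ι)
    (ρ : Matrix (ZMod 2 × ZMod 2) (ZMod 2 × ZMod 2) ℂ) : ℝ :=
  sSup (achievableRates P ρ)

end Yield

end Purification

/-! The yield of any protocol `P` followed by universal hashing has a single-letter form: per block
it is E[number of pairs set aside] − H(K | R), with K the labels set aside (`kept`) and R the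
announced results (`record`); this is `isLUB_achievableRates`. Achievability is random linear
coding: given the records there are at most 2^(L(H+δ)) typical strings K, and two candidates collide
under r random parities with probability 2^(-r) (`card_hash_collision`). Conversely, r hash bits
raise the chance of guessing an untypical string by at most a factor 2^r (`successProb_le`).
Chebyshev's inequality supplies the law of large numbers for the information content and for the
number of pairs set aside.

For AEPP the entropy H(K | R) is found by recursion. A parity check onto `t` adds the phase of `t`
to every source; a later check onto `t'` inside the block cancels that phase and puts the phase of
`t'` in its place (`gather_phaseShift`). So each half set aside looks like a freshly checked even
block, independent of the half in which the search goes on. It contributes one `S` term, and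
entropies of independent halves add (`condEntropy_prodWeight_inter`, `condEntropy_locate`).

For the comparison with hashing, let h be the entropy of one label, and let E_K and O_K be the
entropies of K labels given even and odd parity. The chain rule gives N h = H(p, 1-p) + p E_N +
(1-p) O_N. An odd block of 2K pairs consists of a fair bit naming its odd half, an even half and an
odd half, so O_{2K} = 1 + E_K + O_K, and O_N = n + 1 + E_1 + E_2 + ... + E_{N/2}. This is the
bracket in the yield formula with S_{K-1} replaced by E_K. Hence N times the gain equals H(p, 1-p) −
p plus a nonnegative combination of the differences E_K − S_{K-1} (`two_pow_mul_yield_sub`).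

Such a difference is the entropy of a single phase bit: the shifted string and even parity determine
the labels up to a flip of all phases. A Bhattacharyya estimate makes the total contribution vanish
in the limit for F = 1 − 2^(-n). Finally p ≤ p* and x ↦ H(x, 1-x) − x decreases on [1/2, 1], so the
lower bound holds for every n ≥ 1 and the limit is exactly H(p*, 1-p*) − p*. -/

namespace Purification

open Finset Filter Topology

/-! ### Finite sums over product spaces -/

section Mass

variable {Ω : Type*} [Fintype Ω]

/-- The total weight of a set. -/
noncomputable def mass (w : Ω → ℝ) (E : Set Ω) : ℝ := ∑ x, E.indicator w x

theorem mass_nonneg {w : Ω → ℝ} (hw : ∀ x, 0 ≤ w x) (E : Set Ω) : 0 ≤ mass w E :=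
  sum_nonneg fun _ _ => Set.indicator_nonneg (fun x _ => hw x) _

theorem mass_mono {w : Ω → ℝ} (hw : ∀ x, 0 ≤ w x) {E E' : Set Ω} (h : E ⊆ E') :
    mass w E ≤ mass w E' :=
  sum_le_sum fun _ _ => Set.indicator_le_indicator_of_subset h hw _

theorem mass_mono_of_pos {w : Ω → ℝ} (hw : ∀ x, 0 ≤ w x) {E E' : Set Ω}
    (h : ∀ x, 0 < w x → x ∈ E → x ∈ E') : mass w E ≤ mass w E' := by
  classical
  refine sum_le_sum fun x _ => ?_
  rcases (hw x).eq_or_lt with h0 | h0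
  · simp [Set.indicator_apply, ← h0]
  · by_cases hx : x ∈ E
    · simp [hx, h x h0 hx]
    · simpa [hx] using Set.indicator_nonneg (fun x _ => hw x) _

theorem mass_union_le {w : Ω → ℝ} (hw : ∀ x, 0 ≤ w x) (E E' : Set Ω) :
    mass w (E ∪ E') ≤ mass w E + mass w E' := by
  rw [mass, mass, mass, ← sum_add_distrib]
  refine sum_le_sum fun x _ => ?_
  have := hw x
  by_cases h1 : x ∈ E <;> by_cases h2 : x ∈ E' <;> simp [h1, h2, this]

theorem mass_univ (w : Ω → ℝ) : mass w Set.univ = ∑ x, w x := by simp [mass]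

theorem mass_add_mass_compl (w : Ω → ℝ) (E : Set Ω) : mass w E + mass w Eᶜ = ∑ x, w x := by
  rw [mass, mass, ← sum_add_distrib]
  exact sum_congr rfl fun x _ => Set.indicator_self_add_compl_apply E w x

theorem mass_inter_add_mass_diff (w : Ω → ℝ) (E A : Set Ω) :
    mass w (E ∩ A) + mass w (E \ A) = mass w E := by
  classical
  rw [mass, mass, mass, ← sum_add_distrib]
  refine sum_congr rfl fun x _ => ?_
  by_cases h1 : x ∈ E <;> by_cases h2 : x ∈ A <;> simp [h1, h2]

theorem mass_pos {w : Ω → ℝ} (hw : ∀ x, 0 ≤ w x) {E : Set Ω} {x : Ω} (hx : x ∈ E) (h : 0 < w x) :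
    0 < mass w E :=
  sum_pos' (fun _ _ => Set.indicator_nonneg (fun x _ => hw x) _) ⟨x, mem_univ _, by simpa [hx]⟩

end Mass

section Product

variable {Ω : Type*} [Fintype Ω]

theorem sum_pi_prod {ι : Type*} [Fintype ι] [DecidableEq ι] (g : ι → Ω → ℝ) :
    ∑ x : ι → Ω, ∏ i, g i (x i) = ∏ i, ∑ c, g i c := by
  rw [prod_univ_sum, Fintype.piFinset_univ]

theorem sum_fin_succ_pi {L : ℕ} (φ : (Fin (L + 1) → Ω) → ℝ) :
    ∑ x, φ x = ∑ a, ∑ y : Fin L → Ω, φ (Fin.cons a y) := by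
  rw [← (Fin.consEquiv fun _ => Ω).sum_comp, Fintype.sum_prod_type]
  rfl

/-- Each coordinate contributes equally and the others sum out. The weight `g` is neither normalized
nor nonnegative, because the signed weight `labelWeight * ampSign` is needed later. At `L = 0` the
truncated exponent is harmless thanks to the factor `L`. -/
theorem sum_prod_mul_sum (g h : Ω → ℝ) (L : ℕ) :
    ∑ x : Fin L → Ω, (∏ i, g (x i)) * ∑ i, h (x i) =
      L * (∑ c, g c) ^ (L - 1) * ∑ c, g c * h c := by
  induction L with
  | zero => simp
  | succ L ih =>
    rw [sum_fin_succ_pi]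
    simp only [Fin.prod_univ_succ, Fin.sum_univ_succ, Fin.cons_zero, Fin.cons_succ]
    have h1 : ∀ a, ∑ y : Fin L → Ω, (g a * ∏ i, g (y i)) * (h a + ∑ i, h (y i)) =
        g a * h a * (∑ c, g c) ^ L + g a * (L * (∑ c, g c) ^ (L - 1) * ∑ c, g c * h c) := by
      intro a
      rw [← ih, Fintype.sum_pow, mul_sum, mul_sum, ← sum_add_distrib]
      exact sum_congr rfl fun y _ => by ring
    simp_rw [h1]
    rw [sum_add_distrib, ← sum_mul, ← sum_mul]
    rcases L with _ | L
    · simp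
    · simp only [Nat.add_sub_cancel, pow_succ]
      push_cast
      ring

/-- Additivity of the variance: the cross terms vanish because `f` is centred. -/
theorem sum_prod_mul_sum_sq {w f : Ω → ℝ} (hw : ∑ x, w x = 1) (hf : ∑ x, w x * f x = 0) (L : ℕ) :
    ∑ x : Fin L → Ω, (∏ i, w (x i)) * (∑ i, f (x i)) ^ 2 = L * ∑ x, w x * f x ^ 2 := by
  induction L with
  | zero => simp
  | succ L ih =>
    rw [sum_fin_succ_pi]
    simp only [Fin.prod_univ_succ, Fin.sum_univ_succ, Fin.cons_zero, Fin.cons_succ]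
    have h0 : ∑ y : Fin L → Ω, ∏ i, w (y i) = 1 := by rw [← Fintype.sum_pow, hw, one_pow]
    have h1 : ∑ y : Fin L → Ω, (∏ i, w (y i)) * ∑ i, f (y i) = 0 := by
      rw [sum_prod_mul_sum, hf, mul_zero]
    have h2 : ∀ a, ∑ y : Fin L → Ω, (w a * ∏ i, w (y i)) * (f a + ∑ i, f (y i)) ^ 2 =
        w a * f a ^ 2 + w a * (L * ∑ x, w x * f x ^ 2) := by
      intro a
      calc _ = w a * f a ^ 2 * (∑ y : Fin L → Ω, ∏ i, w (y i)) +
            2 * w a * f a * (∑ y : Fin L → Ω, (∏ i, w (y i)) * ∑ i, f (y i)) +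
            w a * ∑ y : Fin L → Ω, (∏ i, w (y i)) * (∑ i, f (y i)) ^ 2 := by
            rw [mul_sum, mul_sum, mul_sum, ← sum_add_distrib, ← sum_add_distrib]
            exact sum_congr rfl fun y _ => by ring
        _ = _ := by rw [h0, h1, ih]; ring
    simp_rw [h2]
    rw [sum_add_distrib, ← sum_mul, hw]
    push_cast
    ring

/-- Chebyshev's inequality for a sum of `L` independent copies of `f`. -/
theorem mass_deviation_le {w : Ω → ℝ} (hw0 : ∀ x, 0 ≤ w x) (hw : ∑ x, w x = 1) (f : Ω → ℝ)
    {δ : ℝ} (hδ : 0 < δ) {L : ℕ} (hL : 0 < L) :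
    mass (fun X : Fin L → Ω => ∏ l, w (X l))
      {X | δ * L < |∑ l, f (X l) - L * ∑ x, w x * f x|} ≤
      (∑ x, w x * (f x - ∑ x, w x * f x) ^ 2) / δ ^ 2 * (1 / L) := by
  set m := ∑ x, w x * f x with hm
  have h0 : ∑ x, w x * (f x - m) = 0 := by
    simp only [mul_sub, sum_sub_distrib, ← sum_mul, hw, ← hm]; ring
  have h2 := sum_prod_mul_sum_sq hw h0 L
  have hL' : (0 : ℝ) < L := by exact_mod_cast hL
  have hd : 0 < δ * L := by positivity
  have key : (δ * L) ^ 2 * mass (fun X : Fin L → Ω => ∏ l, w (X l))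
      {X | δ * L < |∑ l, f (X l) - L * m|} ≤ L * ∑ x, w x * (f x - m) ^ 2 := by
    rw [← h2, mass, mul_sum]
    refine sum_le_sum fun X _ => ?_
    have hp : 0 ≤ ∏ l, w (X l) := prod_nonneg fun l _ => hw0 _
    by_cases hX : X ∈ {X : Fin L → Ω | δ * L < |∑ l, f (X l) - L * m|}
    · rw [Set.indicator_of_mem hX, mul_comm]
      refine mul_le_mul_of_nonneg_left ?_ hp
      have : ∑ i, (f (X i) - m) = ∑ l, f (X l) - L * m := by simp [sum_sub_distrib]
      rw [this, ← sq_abs (_ - _)]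
      exact pow_le_pow_left₀ hd.le (le_of_lt hX) 2
    · rw [Set.indicator_of_notMem hX, mul_zero]
      positivity
  rw [div_mul_div_comm, le_div_iff₀ (by positivity)]
  have h3 : L * (mass (fun X : Fin L → Ω => ∏ l, w (X l))
      {X | δ * L < |∑ l, f (X l) - L * m|} * (δ ^ 2 * L)) ≤ L * ∑ x, w x * (f x - m) ^ 2 := by
    refine le_trans (le_of_eq ?_) key
    ring
  simpa using le_of_mul_le_mul_left h3 hL'

theorem tendsto_mass_deviation {w : Ω → ℝ} (hw0 : ∀ x, 0 ≤ w x) (hw : ∑ x, w x = 1) (f : Ω → ℝ)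
    {δ : ℝ} (hδ : 0 < δ) :
    Filter.Tendsto (fun L : ℕ => mass (fun X : Fin L → Ω => ∏ l, w (X l))
      {X | δ * L < |∑ l, f (X l) - L * ∑ x, w x * f x|}) Filter.atTop (nhds 0) := by
  have h := (tendsto_one_div_atTop_nhds_zero_nat (𝕜 := ℝ)).const_mul
    ((∑ x, w x * (f x - ∑ x, w x * f x) ^ 2) / δ ^ 2)
  rw [mul_zero] at h
  refine tendsto_of_tendsto_of_tendsto_of_le_of_le' tendsto_const_nhds h
    (Filter.Eventually.of_forall fun L => mass_nonneg (fun X => prod_nonneg fun l _ => hw0 _) _) ?_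
  filter_upwards [Filter.eventually_gt_atTop 0] with L hL
  exact mass_deviation_le hw0 hw f hδ hL

theorem sum_prod_comp {Z : Type*} [Fintype Z] [DecidableEq Z] (w : Ω → ℝ) (g : Ω → Z) {L : ℕ}
    (φ : (Fin L → Z) → ℝ) :
    ∑ X : Fin L → Ω, (∏ l, w (X l)) * φ (fun l => g (X l)) =
      ∑ z : Fin L → Z, (∏ l, ∑ x, if g x = z l then w x else 0) * φ z := by
  have h : ∀ z : Fin L → Z, (∏ l, ∑ x, if g x = z l then w x else 0) =
      ∑ X : Fin L → Ω, if (fun l => g (X l)) = z then ∏ l, w (X l) else 0 := by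
    intro z
    rw [← sum_pi_prod (fun l x => if g x = z l then w x else 0)]
    refine sum_congr rfl fun X _ => ?_
    split_ifs with hz
    · subst hz; simp
    · obtain ⟨l, hl⟩ := Function.ne_iff.1 hz
      exact prod_eq_zero (mem_univ l) (if_neg hl)
  simp_rw [h, sum_mul]
  rw [sum_comm]
  refine sum_congr rfl fun X _ => ?_
  simp [ite_mul]

end Product

/-! ### Conditional entropy -/

section CondEntropy

variable {Ω A B : Type*} [Fintype Ω]

/-- The conditional probability of `K = a` given `R = b`, for a not necessarily normalized
weight `w`. -/
noncomputable def condProb (w : Ω → ℝ) (K : Ω → A) (R : Ω → B) (a : A) (b : B) : ℝ :=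
  mass w {x | K x = a ∧ R x = b} / mass w {x | R x = b}

/-- The conditional entropy of `K` given `R`, in bits, multiplied by the total weight. -/
noncomputable def condEntropy (w : Ω → ℝ) (K : Ω → A) (R : Ω → B) : ℝ :=
  ∑ x, w x * -Real.logb 2 (condProb w K R (K x) (R x))

theorem condProb_nonneg {w : Ω → ℝ} (hw : ∀ x, 0 ≤ w x) (K : Ω → A) (R : Ω → B) (a : A) (b : B) :
    0 ≤ condProb w K R a b :=
  div_nonneg (mass_nonneg hw _) (mass_nonneg hw _)

theorem condProb_self_pos {w : Ω → ℝ} (hw : ∀ x, 0 ≤ w x) (K : Ω → A) (R : Ω → B) {x : Ω}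
    (hx : 0 < w x) : 0 < condProb w K R (K x) (R x) :=
  div_pos (mass_pos hw (by simp) hx) (mass_pos hw (x := x) (by simp) hx)

theorem exists_of_condProb_pos {w : Ω → ℝ} {K : Ω → A} {R : Ω → B} {a : A} {b : B}
    (h : 0 < condProb w K R a b) : ∃ x, K x = a ∧ R x = b := by
  by_contra! hne
  have : {x | K x = a ∧ R x = b} = ∅ := by
    ext x
    simpa using hne x
  simp [condProb, this, mass] at h

theorem sum_mass_fiber [Fintype A] (w : Ω → ℝ) (K : Ω → A) (E : Set Ω) :
    ∑ a, mass w {x | K x = a ∧ x ∈ E} = mass w E := by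
  classical
  simp only [mass]
  rw [sum_comm]
  refine sum_congr rfl fun x _ => ?_
  by_cases hx : x ∈ E <;> simp [Set.indicator_apply, hx]

theorem sum_condProb_le [Fintype A] {w : Ω → ℝ} (K : Ω → A) (R : Ω → B) (b : B) :
    ∑ a, condProb w K R a b ≤ 1 := by
  simp only [condProb]
  rw [← sum_div]
  have := sum_mass_fiber w K {x | R x = b}
  simp only [Set.mem_ofPred_eq] at this
  rw [this]
  exact div_self_le_one _

/-- The products of conditional probabilities given `b` sum to at most one over all strings, so at
most `1 / t` strings can reach `t`. -/
theorem card_typical_mul_le [Fintype A] {w : Ω → ℝ} (hw : ∀ x, 0 ≤ w x)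
    (K : Ω → A) (R : Ω → B) {L : ℕ} (b : Fin L → B) {t : ℝ} (T : Finset (Fin L → A))
    (hT : ∀ a ∈ T, t ≤ ∏ l, condProb w K R (a l) (b l)) : (#T : ℝ) * t ≤ 1 := by
  have h0 : ∀ a : Fin L → A, 0 ≤ ∏ l, condProb w K R (a l) (b l) := fun a =>
    prod_nonneg fun l _ => condProb_nonneg hw _ _ _ _
  have h1 := card_nsmul_le_sum T (fun a => ∏ l, condProb w K R (a l) (b l)) t hT
  rw [nsmul_eq_mul] at h1
  refine h1.trans ((sum_le_sum_of_subset_of_nonneg (subset_univ T) fun a _ _ => h0 a).trans ?_)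
  rw [sum_pi_prod fun l a => condProb w K R a (b l)]
  exact prod_le_one (fun l _ => sum_nonneg fun a _ => condProb_nonneg hw _ _ _ _)
    fun l _ => sum_condProb_le K R (b l)

/-- Once the record `b` is fixed, only the string `d b` can be guessed correctly. It counts only if
its conditional probability is at most `t`; averaging over `b` preserves the bound. -/
theorem mass_guess_le_of_fintype [Fintype A] [Fintype B] {w : Ω → ℝ} (hw : ∀ x, 0 ≤ w x)
    (hw1 : ∑ x, w x = 1) (K : Ω → A) (R : Ω → B) {L : ℕ} (d : (Fin L → B) → Fin L → A) {t : ℝ}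
    (ht0 : 0 ≤ t) :
    mass (fun X : Fin L → Ω => ∏ l, w (X l))
      {X | (fun l => K (X l)) = d (fun l => R (X l)) ∧
        ∏ l, condProb w K R (K (X l)) (R (X l)) ≤ t} ≤ t := by
  classical
  set π : A × B → ℝ := fun z => mass w {x | K x = z.1 ∧ R x = z.2} with hπ
  set m : B → ℝ := fun b => mass w {x | R x = b} with hm
  have hπ0 : ∀ z, 0 ≤ π z := fun z => mass_nonneg hw _
  have hm0 : ∀ z, 0 ≤ m z := fun z => mass_nonneg hw _
  have hle : ∀ z, π z ≤ m z.2 := fun z => mass_mono hw fun x hx => hx.2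
  have hm1 : ∑ b, m b = 1 := by
    have := sum_mass_fiber w R Set.univ
    simpa [mass_univ, hw1] using this
  let φ : (Fin L → A × B) → ℝ := fun z =>
    if (fun l => (z l).1) = d (fun l => (z l).2) ∧
      ∏ l, condProb w K R (z l).1 (z l).2 ≤ t then 1 else 0
  have h1 : mass (fun X : Fin L → Ω => ∏ l, w (X l))
      {X | (fun l => K (X l)) = d (fun l => R (X l)) ∧
        ∏ l, condProb w K R (K (X l)) (R (X l)) ≤ t} =
      ∑ z : Fin L → A × B, (∏ l, π (z l)) * φ z := by
    have := sum_prod_comp w (fun x => (K x, R x)) φ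
    have hπ' : ∀ z : A × B, π z = ∑ x, if (K x, R x) = z then w x else 0 := by
      intro z
      simp only [hπ, mass]
      exact sum_congr rfl fun x _ => by simp [Set.indicator_apply, Prod.ext_iff]
    simp only [hπ']
    rw [← this, mass]
    exact sum_congr rfl fun X _ => by simp [φ, Set.indicator_apply]
  rw [h1, ← (Equiv.arrowProdEquivProdArrow (Fin L) (fun _ => A) (fun _ => B)).symm.sum_comp,
    Fintype.sum_prod_type, sum_comm]
  have h2 : ∀ b : Fin L → B, ∑ a : Fin L → A, (∏ l, π (a l, b l)) *
      (if a = d b ∧ ∏ l, condProb w K R (a l) (b l) ≤ t then (1 : ℝ) else 0) ≤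
      t * ∏ l, m (b l) := by
    intro b
    rw [sum_eq_single (d b) (by intro a _ ha; simp [ha]) (by simp)]
    have hP : ∏ l, π (d b l, b l) =
        (∏ l, condProb w K R (d b l) (b l)) * ∏ l, m (b l) := by
      rw [← prod_mul_distrib]
      refine prod_congr rfl fun l _ => ?_
      -- For a record of weight zero `condProb` is a division by zero, but both sides vanish.
      rcases (hm0 (b l)).eq_or_lt with h0 | h0
      · rw [← h0, mul_zero]
        exact le_antisymm ((hle (d b l, b l)).trans_eq h0.symm) (hπ0 _)
      · rw [condProb, div_mul_cancel₀ _ h0.ne']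
    have hpm : 0 ≤ ∏ l, m (b l) := prod_nonneg fun l _ => hm0 _
    by_cases ht : ∏ l, condProb w K R (d b l) (b l) ≤ t
    · rw [if_pos ⟨rfl, ht⟩, mul_one, hP]
      exact mul_le_mul_of_nonneg_right ht hpm
    · rw [if_neg fun h => ht h.2, mul_zero]
      positivity
  refine (sum_le_sum fun b _ => h2 b).trans_eq ?_
  rw [← mul_sum, sum_pi_prod (fun _ b => m b), hm1]
  simp

/-- Records are lists, an infinite type; only the finitely many values taken by `R` matter, so `B`
is replaced by the range of `R`. -/
theorem mass_guess_le [Fintype A] {w : Ω → ℝ} (hw : ∀ x, 0 ≤ w x)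
    (hw1 : ∑ x, w x = 1) (K : Ω → A) (R : Ω → B) {L : ℕ} (d : (Fin L → B) → Fin L → A) {t : ℝ}
    (ht0 : 0 ≤ t) :
    mass (fun X : Fin L → Ω => ∏ l, w (X l))
      {X | (fun l => K (X l)) = d (fun l => R (X l)) ∧
        ∏ l, condProb w K R (K (X l)) (R (X l)) ≤ t} ≤ t := by
  classical
  have := mass_guess_le_of_fintype hw hw1 K (Set.rangeFactorization R)
    (fun b => d fun l => (b l : B)) ht0
  have hc : ∀ x, condProb w K (Set.rangeFactorization R) (K x) (Set.rangeFactorization R x) =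
      condProb w K R (K x) (R x) := by
    intro x
    simp [condProb, Set.rangeFactorization, Subtype.ext_iff]
  simp only [hc] at this
  exact this

end CondEntropy

/-! ### Random linear hashing -/

section Hashing

/-- A protocol branches only on announced results, so the record determines which pairs are set
aside. The decoder thus only has to tell apart strings with the same pattern of `none`. -/
theorem Protocol.isSome_kept_eq_of_record_eq {ι : Type} [DecidableEq ι] (P : Protocol ι) {x x' : ι → Label}
    (h : P.record x = P.record x') (i : ι) : (P.kept x i).isSome = (P.kept x' i).isSome := by
  induction P generalizing x x' with
  | done => rfl
  | bxor i j next ih => exact ih h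
  | measure j next ih =>
    simp only [Protocol.record, List.cons.injEq] at h
    obtain ⟨h1, h2⟩ := h
    simp only [Protocol.kept]
    rw [h1] at h2 ⊢
    exact ih _ h2
  | hash G next ih =>
    simp only [Protocol.kept]
    split_ifs
    · rfl
    · exact ih h

variable {ι : Type} [Fintype ι] [DecidableEq ι]

/-- The parities of the strings `κ` of kept labels over the subsets selected by `s`. -/
def hashOf {L r : ℕ} (s : Fin r → Fin L → ι → Label) (κ : Fin L → ι → Option Label) :
    Fin r → ZMod 2 := fun j => ∑ l, ∑ i, pairParity (s j l i) (κ l i)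

theorem pairParity_add (s s' : Label) (o : Option Label) :
    pairParity (s + s') o = pairParity s o + pairParity s' o := by
  cases o with
  | none => rfl
  | some c => simp only [pairParity, Prod.fst_add, Prod.snd_add]; ring

theorem exists_pairParity_eq_one : ∀ c c' : Label, c ≠ c' →
    ∃ d : Label, pairParity d (some c) + pairParity d (some c') = 1 := by
  simp only [pairParity]
  decide

/-- Translation by `v` exchanges the kernel of `ψ` with its complement. -/
theorem two_mul_card_filter_eq_zero {V : Type*} [AddGroup V] [Fintype V] (ψ : V → ZMod 2)
    (hψ : ∀ u v, ψ (u + v) = ψ u + ψ v) {v : V} (hv : ψ v = 1) :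
    #{u | ψ u = 0} * 2 = Fintype.card V := by
  have h1 : #{u | ψ u = 0} = #{u | ¬ ψ u = 0} := by
    refine card_equiv (Equiv.addRight v) fun u => ?_
    simp only [mem_filter, mem_univ, true_and, Equiv.coe_addRight, hψ, hv]
    generalize ψ u = a
    revert a
    decide
  have h2 := card_filter_add_card_filter_not (s := (univ : Finset V)) (fun u => ψ u = 0)
  rw [card_univ] at h2
  omega

/-- In one round the subset `u` fails to separate the strings iff `ψ u = 0`, where `ψ` is additive
and takes the value one on a suitable subset of the two bits of a pair where they differ. So half of
the subsets fail, independently in each round. Equality of patterns excludes `none` against `some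
0`, which no subset separates. -/
theorem card_hash_collision {L : ℕ} (r : ℕ) {κ κ' : Fin L → ι → Option Label} (hne : κ ≠ κ')
    (hpat : ∀ l i, (κ l i).isSome = (κ' l i).isSome) :
    #{s : Fin r → Fin L → ι → Label | hashOf s κ = hashOf s κ'} * 2 ^ r =
      Fintype.card (Fin r → Fin L → ι → Label) := by
  obtain ⟨l, hl⟩ := Function.ne_iff.1 hne
  obtain ⟨i, hi⟩ := Function.ne_iff.1 hl
  obtain ⟨d, hd⟩ : ∃ d : Label, pairParity d (κ l i) + pairParity d (κ' l i) = 1 := by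
    have hp := hpat l i
    cases h1 : κ l i with
    | none => cases h2 : κ' l i with
      | none => simp [h1, h2] at hi
      | some c' => simp [h1, h2] at hp
    | some c => cases h2 : κ' l i with
      | none => simp [h1, h2] at hp
      | some c' => exact exists_pairParity_eq_one c c' (by rw [h1, h2] at hi; simpa using hi)
  let ψ : (Fin L → ι → Label) → ZMod 2 := fun u =>
    (∑ l, ∑ i, pairParity (u l i) (κ l i)) + ∑ l, ∑ i, pairParity (u l i) (κ' l i)
  have hψ : ∀ u v, ψ (u + v) = ψ u + ψ v := by
    intro u v
    simp only [ψ, Pi.add_apply, pairParity_add, sum_add_distrib]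
    ring
  have hsingle : ∀ κ : Fin L → ι → Option Label,
      ∑ l', ∑ i', pairParity ((Pi.single l (Pi.single i d) : Fin L → ι → Label) l' i') (κ l' i') =
        pairParity d (κ l i) := by
    intro κ
    have hz : ∀ o, pairParity 0 o = 0 := fun o => by cases o <;> simp [pairParity]
    rw [sum_eq_single l, sum_eq_single i]
    · simp
    · intro i' _ hi'; simp [hi', hz]
    · simp
    · intro l' _ hl'; simp [hl', hz]
    · simp
  have hv : ψ (Pi.single l (Pi.single i d)) = 1 := by
    simp only [ψ, hsingle, hd]
  have hcard := two_mul_card_filter_eq_zero ψ hψ hv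
  have hset : ({s : Fin r → Fin L → ι → Label | hashOf s κ = hashOf s κ'} : Finset _) =
      Fintype.piFinset fun _ => {u | ψ u = 0} := by
    ext s
    simp only [mem_filter, mem_univ, true_and, Fintype.mem_piFinset, funext_iff, hashOf, ψ]
    exact forall_congr' fun j => by
      generalize (∑ l, ∑ i, pairParity (s j l i) (κ l i)) = a
      generalize (∑ l, ∑ i, pairParity (s j l i) (κ' l i)) = b
      revert a b
      decide
  rw [hset, Fintype.card_piFinset, prod_const, card_univ, Fintype.card_fin, ← mul_pow, hcard,
    Fintype.card_fun (α := Fin r), Fintype.card_fin]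

end Hashing

/-! ### Success probabilities -/

section Success

variable {ι : Type} [Fintype ι] [DecidableEq ι] {P : Protocol ι}
  {ρ : Matrix (ZMod 2 × ZMod 2) (ZMod 2 × ZMod 2) ℂ}

theorem successProb_eq (P : Protocol ι) (ρ : Matrix (ZMod 2 × ZMod 2) (ZMod 2 × ZMod 2) ℂ)
    (y : ℝ) (L r : ℕ) (D : Decoder ι L r) :
    successProb P ρ y L r D = (∑ s : Fin r → Fin L → ι → Label,
      mass (fun X : Fin L → ι → Label => ∏ l, stringWeight ρ (X l))
        {X | D s (fun l => P.record (X l)) (hashOf s fun l => P.kept (X l)) =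
            (fun l => P.kept (X l)) ∧
          y * ((Fintype.card ι : ℝ) * (L : ℝ)) ≤ (keptCount P X : ℝ) - (r : ℝ)}) /
      (Fintype.card (Fin r → Fin L → ι → Label) : ℝ) := by
  classical
  simp only [successProb, mass, Set.indicator_apply]
  rfl

/-- Union bound: each `X` has at most `1 / t` competitors of conditional probability at least `t`,
and each of them collides for a fraction `2 ^ (-r)` of the choices of subsets. -/
theorem sum_mass_collision_le (hw : ∀ x : ι → Label, 0 ≤ stringWeight ρ x)
    (hw1 : ∑ x : ι → Label, stringWeight ρ x = 1) {L : ℕ} (r : ℕ) {t : ℝ} (ht : 0 < t) :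
    ∑ s : Fin r → Fin L → ι → Label,
      mass (fun X : Fin L → ι → Label => ∏ l, stringWeight ρ (X l))
        {X | ∃ κ : Fin L → ι → Option Label, κ ≠ (fun l => P.kept (X l)) ∧
          t ≤ ∏ l, condProb (stringWeight ρ) P.kept P.record (κ l) (P.record (X l)) ∧
          hashOf s κ = hashOf s fun l => P.kept (X l)} ≤
      (1 / t) * ((Fintype.card (Fin r → Fin L → ι → Label) : ℝ) / 2 ^ r) := by
  classical
  set W : (Fin L → ι → Label) → ℝ := fun X => ∏ l, stringWeight ρ (X l) with hW
  have hW0 : ∀ X, 0 ≤ W X := fun X => prod_nonneg fun l _ => hw _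
  have hW1 : ∑ X, W X = 1 := by
    rw [hW, ← Fintype.sum_pow, hw1, one_pow]
  set c : ℝ := (1 / t) * ((Fintype.card (Fin r → Fin L → ι → Label) : ℝ) / 2 ^ r)
  simp only [mass]
  rw [sum_comm]
  calc _ ≤ ∑ X, W X * c := by
        refine sum_le_sum fun X _ => ?_
        set T : Finset (Fin L → ι → Option Label) := {κ | κ ≠ (fun l => P.kept (X l)) ∧
          t ≤ ∏ l, condProb (stringWeight ρ) P.kept P.record (κ l) (P.record (X l))} with hT
        have hcoll : ∀ κ ∈ T,
            (#{s : Fin r → Fin L → ι → Label | hashOf s κ = hashOf s fun l => P.kept (X l)} : ℝ) =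
              (Fintype.card (Fin r → Fin L → ι → Label) : ℝ) / 2 ^ r := by
          intro κ hκ
          rw [hT, mem_filter] at hκ
          -- Positive conditional probability means that `κ l` is really the outcome of some labels
          -- with the same record, hence has the same pattern.
          have hpat : ∀ l i, (κ l i).isSome = (P.kept (X l) i).isSome := by
            intro l i
            have hne : condProb (stringWeight ρ) P.kept P.record (κ l) (P.record (X l)) ≠ 0 :=
              prod_ne_zero_iff.1 (ht.trans_le hκ.2.2).ne' l (mem_univ _)
            obtain ⟨x, hx1, hx2⟩ := exists_of_condProb_pos
              (lt_of_le_of_ne (condProb_nonneg hw _ _ _ _) hne.symm)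
            rw [← hx1]
            exact P.isSome_kept_eq_of_record_eq hx2 i
          rw [eq_div_iff (by positivity)]
          exact_mod_cast card_hash_collision r hκ.2.1 hpat
        calc _ ≤ ∑ s : Fin r → Fin L → ι → Label, ∑ κ ∈ T,
                if hashOf s κ = hashOf s fun l => P.kept (X l) then W X else 0 := by
              refine sum_le_sum fun s _ => ?_
              have hterm : ∀ κ ∈ T, 0 ≤
                  if hashOf s κ = hashOf s fun l => P.kept (X l) then W X else 0 := by
                intro κ _
                split_ifs
                exacts [hW0 X, le_rfl]
              refine Set.indicator_apply_le' (fun hX => ?_) fun _ => sum_nonneg hterm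
              obtain ⟨κ, h1, h2, h3⟩ := hX
              refine le_trans (le_of_eq ?_)
                (single_le_sum hterm (mem_filter.2 ⟨mem_univ κ, h1, h2⟩))
              rw [if_pos h3]
          _ = #T * (W X * ((Fintype.card (Fin r → Fin L → ι → Label) : ℝ) / 2 ^ r)) := by
              rw [sum_comm, ← nsmul_eq_mul, ← sum_const]
              refine sum_congr rfl fun κ hκ => ?_
              rw [← hcoll κ hκ, ← sum_filter, sum_const, nsmul_eq_mul, mul_comm]
          _ = W X * (#T * ((Fintype.card (Fin r → Fin L → ι → Label) : ℝ) / 2 ^ r)) := by ring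
          _ ≤ W X * c := by
              refine mul_le_mul_of_nonneg_left (mul_le_mul_of_nonneg_right ?_ (by positivity))
                (hW0 X)
              rw [le_div_iff₀ ht]
              exact card_typical_mul_le hw P.kept P.record _ T fun κ hκ => (mem_filter.1 hκ).2.2
    _ = c := by rw [← sum_mul, hW1, one_mul]

/-- The decoder returns any string of conditional probability at least `t` that agrees with the
hash. Success can fail only through an untypical true string, too few remaining pairs, or a
collision; these are the three subtracted terms. -/
theorem exists_decoder_le_successProb (P : Protocol ι) (hw : ∀ x : ι → Label, 0 ≤ stringWeight ρ x)
    (hw1 : ∑ x : ι → Label, stringWeight ρ x = 1) (y : ℝ) (L r : ℕ) {t : ℝ} (ht : 0 < t) :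
    ∃ D : Decoder ι L r,
      1 - mass (fun X : Fin L → ι → Label => ∏ l, stringWeight ρ (X l))
          {X | ∏ l, condProb (stringWeight ρ) P.kept P.record (P.kept (X l)) (P.record (X l)) < t} -
        mass (fun X : Fin L → ι → Label => ∏ l, stringWeight ρ (X l))
          {X | (keptCount P X : ℝ) - (r : ℝ) < y * ((Fintype.card ι : ℝ) * (L : ℝ))} -
        (1 / t) / 2 ^ r ≤ successProb P ρ y L r D := by
  classical
  set W : (Fin L → ι → Label) → ℝ := fun X => ∏ l, stringWeight ρ (X l) with hW
  have hW0 : ∀ X, 0 ≤ W X := fun X => prod_nonneg fun l _ => hw _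
  have hW1 : ∑ X, W X = 1 := by
    rw [hW, ← Fintype.sum_pow, hw1, one_pow]
  let good (s : Fin r → Fin L → ι → Label) (b : Fin L → List (ZMod 2)) (h : Fin r → ZMod 2)
    (κ : Fin L → ι → Option Label) : Prop :=
    t ≤ ∏ l, condProb (stringWeight ρ) P.kept P.record (κ l) (b l) ∧ hashOf s κ = h
  let D : Decoder ι L r := fun s b h =>
    if hx : ∃ κ, good s b h κ then hx.choose else fun _ _ => none
  refine ⟨D, ?_⟩
  set B1 : Set (Fin L → ι → Label) :=
    {X | ∏ l, condProb (stringWeight ρ) P.kept P.record (P.kept (X l)) (P.record (X l)) < t}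
  set B2 : Set (Fin L → ι → Label) :=
    {X | (keptCount P X : ℝ) - (r : ℝ) < y * ((Fintype.card ι : ℝ) * (L : ℝ))}
  let C (s : Fin r → Fin L → ι → Label) : Set (Fin L → ι → Label) :=
    {X | ∃ κ : Fin L → ι → Option Label, κ ≠ (fun l => P.kept (X l)) ∧
      t ≤ ∏ l, condProb (stringWeight ρ) P.kept P.record (κ l) (P.record (X l)) ∧
      hashOf s κ = hashOf s fun l => P.kept (X l)}
  set N : ℝ := (Fintype.card (Fin r → Fin L → ι → Label) : ℝ) with hN
  have hNpos : 0 < N := by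
    rw [hN]
    exact_mod_cast Fintype.card_pos
  rw [successProb_eq, le_div_iff₀ hNpos]
  have hs : ∀ s : Fin r → Fin L → ι → Label, 1 - mass W B1 - mass W B2 - mass W (C s) ≤
      mass W {X | D s (fun l => P.record (X l)) (hashOf s fun l => P.kept (X l)) =
            (fun l => P.kept (X l)) ∧
          y * ((Fintype.card ι : ℝ) * (L : ℝ)) ≤ (keptCount P X : ℝ) - (r : ℝ)} := by
    intro s
    set S := {X | D s (fun l => P.record (X l)) (hashOf s fun l => P.kept (X l)) =
            (fun l => P.kept (X l)) ∧
          y * ((Fintype.card ι : ℝ) * (L : ℝ)) ≤ (keptCount P X : ℝ) - (r : ℝ)} with hS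
    have hsub : Sᶜ ⊆ (B1 ∪ B2) ∪ C s := by
      intro X hX
      by_contra hnot
      simp only [Set.mem_union, not_or] at hnot
      obtain ⟨⟨hb1, hb2⟩, hc⟩ := hnot
      apply hX
      have hb1' : t ≤ ∏ l, condProb (stringWeight ρ) P.kept P.record (P.kept (X l))
        (P.record (X l)) := not_lt.1 hb1
      refine ⟨?_, not_lt.1 hb2⟩
      have hx : ∃ κ, good s (fun l => P.record (X l)) (hashOf s fun l => P.kept (X l)) κ :=
        ⟨fun l => P.kept (X l), hb1', rfl⟩
      simp only [D, dif_pos hx]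
      by_contra hne
      exact hc ⟨hx.choose, hne, hx.choose_spec.1, hx.choose_spec.2⟩
    have h1 := mass_add_mass_compl W S
    have h2 := mass_mono hW0 hsub
    have h3 := mass_union_le hW0 (B1 ∪ B2) (C s)
    have h4 := mass_union_le hW0 B1 B2
    linarith
  have hC : ∑ s, mass W (C s) ≤ 1 / t * (N / 2 ^ r) := sum_mass_collision_le hw hw1 r ht
  refine le_trans ?_ (sum_le_sum fun s _ => hs s)
  rw [sum_sub_distrib, sum_const, card_univ, nsmul_eq_mul, ← hN]
  have : 1 / t / 2 ^ r * N = 1 / t * (N / 2 ^ r) := by ring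
  nlinarith

/-- For a fixed hash value the decoder is a guess from the records alone, so `mass_guess_le` bounds
its success on strings of conditional probability at most `t`. Summation over the `2 ^ r` hash
values gives the last term. -/
theorem successProb_le (P : Protocol ι) (hw : ∀ x : ι → Label, 0 ≤ stringWeight ρ x)
    (hw1 : ∑ x : ι → Label, stringWeight ρ x = 1) (y : ℝ) (L r : ℕ) (D : Decoder ι L r) {t : ℝ}
    (ht : 0 ≤ t) :
    successProb P ρ y L r D ≤
      mass (fun X : Fin L → ι → Label => ∏ l, stringWeight ρ (X l))
          {X | y * ((Fintype.card ι : ℝ) * (L : ℝ)) ≤ (keptCount P X : ℝ) - (r : ℝ) ∧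
            t < ∏ l, condProb (stringWeight ρ) P.kept P.record (P.kept (X l)) (P.record (X l))} +
        2 ^ r * t := by
  classical
  set W : (Fin L → ι → Label) → ℝ := fun X => ∏ l, stringWeight ρ (X l) with hW
  have hW0 : ∀ X, 0 ≤ W X := fun X => prod_nonneg fun l _ => hw _
  set B : Set (Fin L → ι → Label) :=
    {X | y * ((Fintype.card ι : ℝ) * (L : ℝ)) ≤ (keptCount P X : ℝ) - (r : ℝ) ∧
      t < ∏ l, condProb (stringWeight ρ) P.kept P.record (P.kept (X l)) (P.record (X l))}
  have hNpos : (0 : ℝ) < (Fintype.card (Fin r → Fin L → ι → Label) : ℝ) := by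
    exact_mod_cast Fintype.card_pos
  rw [successProb_eq, div_le_iff₀ hNpos]
  refine (sum_le_card_nsmul _ _ (mass W B + 2 ^ r * t) fun s _ => ?_).trans_eq ?_
  · let E (h : Fin r → ZMod 2) : Set (Fin L → ι → Label) :=
      {X | (fun l => P.kept (X l)) = D s (fun l => P.record (X l)) h ∧
        ∏ l, condProb (stringWeight ρ) P.kept P.record (P.kept (X l)) (P.record (X l)) ≤ t}
    have hE : ∀ h, mass W (E h) ≤ t := fun h =>
      mass_guess_le hw hw1 P.kept P.record (fun b => D s b h) ht
    have hEs : ∑ h, mass W (E h) ≤ 2 ^ r * t := by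
      refine (sum_le_card_nsmul _ _ t fun h _ => hE h).trans_eq ?_
      simp
    refine le_trans ?_ (add_le_add_right hEs _)
    simp only [mass]
    rw [sum_comm, ← sum_add_distrib]
    refine sum_le_sum fun X _ => ?_
    have hEn : ∀ h, 0 ≤ (E h).indicator W X :=
      fun h => Set.indicator_nonneg (fun x _ => hW0 x) _
    have hBn : 0 ≤ B.indicator W X := Set.indicator_nonneg (fun x _ => hW0 x) _
    have hsum : 0 ≤ ∑ h, (E h).indicator W X := sum_nonneg fun h _ => hEn h
    refine Set.indicator_apply_le' (fun hX => ?_) fun _ => by positivity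
    by_cases hQ : t < ∏ l, condProb (stringWeight ρ) P.kept P.record (P.kept (X l))
        (P.record (X l))
    · rw [Set.indicator_of_mem (show X ∈ B from ⟨hX.2, hQ⟩)]
      linarith
    · have hXE : X ∈ E (hashOf s fun l => P.kept (X l)) := ⟨hX.1.symm, not_lt.1 hQ⟩
      have := single_le_sum (fun h _ => hEn h) (mem_univ (hashOf s fun l => P.kept (X l)))
      rw [Set.indicator_of_mem hXE] at this
      linarith
  · rw [card_univ, nsmul_eq_mul, mul_comm]

end Success

/-! ### Typical strings: products of conditional probabilities as powers of two -/

section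

variable {Ω A B : Type*} [Fintype Ω]

theorem condProb_le_one {w : Ω → ℝ} (hw : ∀ x, 0 ≤ w x) (K : Ω → A) (R : Ω → B) (a : A) (b : B) :
    condProb w K R a b ≤ 1 :=
  div_le_one_of_le₀ (mass_mono hw fun _ hx => hx.2) (mass_nonneg hw _)

theorem condEntropy_nonneg {w : Ω → ℝ} (hw : ∀ x, 0 ≤ w x) (K : Ω → A) (R : Ω → B) :
    0 ≤ condEntropy w K R :=
  sum_nonneg fun x _ => mul_nonneg (hw x) <| neg_nonneg.2 <|
    Real.logb_nonpos one_lt_two (condProb_nonneg hw _ _ _ _) (condProb_le_one hw _ _ _ _)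

/-- Turns a threshold for the product into one for a sum, to which the law of large numbers applies.
Positive weight is needed because `Real.logb 2 0 = 0`. -/
theorem prod_condProb_eq_rpow {w : Ω → ℝ} (hw : ∀ x, 0 ≤ w x) (K : Ω → A) (R : Ω → B) {L : ℕ}
    {X : Fin L → Ω} (hX : 0 < ∏ l, w (X l)) :
    ∏ l, condProb w K R (K (X l)) (R (X l)) =
      (2 : ℝ) ^ (-∑ l, -Real.logb 2 (condProb w K R (K (X l)) (R (X l)))) := by
  rw [← sum_neg_distrib, Real.rpow_sum_of_pos two_pos]
  refine prod_congr rfl fun l _ => ?_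
  have hl : 0 < w (X l) := lt_of_le_of_ne (hw _) (prod_ne_zero_iff.1 hX.ne' l (mem_univ l)).symm
  rw [neg_neg, Real.rpow_logb two_pos (by norm_num) (condProb_self_pos hw K R hl)]

end

/-! ### The single-letter formula for the yield -/

section

variable {ι : Type} [Fintype ι] [DecidableEq ι]

/-- The number of pairs set aside for hashing in one block. -/
def keptNum (P : Protocol ι) (x : ι → Label) : ℕ := #{i | (P.kept x i).isSome}

variable {ρ : Matrix (ZMod 2 × ZMod 2) (ZMod 2 × ZMod 2) ℂ}

theorem keptCount_eq (P : Protocol ι) {L : ℕ} (X : Fin L → ι → Label) :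
    (keptCount P X : ℝ) = ∑ l, (keptNum P (X l) : ℝ) := by
  rw [← Nat.cast_sum]
  rfl

theorem mem_achievableRates_of_lt (P : Protocol ι) (hw : ∀ x : ι → Label, 0 ≤ stringWeight ρ x)
    (hw1 : ∑ x : ι → Label, stringWeight ρ x = 1) {y : ℝ}
    (hy : y * Fintype.card ι < ∑ x, stringWeight ρ x * keptNum P x -
      condEntropy (stringWeight ρ) P.kept P.record) : y ∈ achievableRates P ρ := by
  set H := condEntropy (stringWeight ρ) P.kept P.record with hH
  set E := ∑ x, stringWeight ρ x * keptNum P x with hE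
  -- Budget for the slack `4 * δ`: one `δ` for typicality in `t`, a second one in `r` to make
  -- collisions rare, a third for the deviation of the number of pairs set aside, and the last for
  -- the rounding in `r`, once `L * δ ≥ 1`.
  obtain ⟨δ, hδ, hδy⟩ : ∃ δ : ℝ, 0 < δ ∧ y * Fintype.card ι + 4 * δ = E - H :=
    ⟨(E - H - y * Fintype.card ι) / 4, by linarith, by ring⟩
  have hH0 : 0 ≤ H := condEntropy_nonneg hw _ _
  let r : ℕ → ℕ := fun L => ⌈L * (H + 2 * δ)⌉₊
  let t : ℕ → ℝ := fun L => 2 ^ (-(L * (H + δ)))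
  have ht : ∀ L, 0 < t L := fun L => Real.rpow_pos_of_pos two_pos _
  choose D hD using fun L => exists_decoder_le_successProb P hw hw1 y L (r L) (ht L)
  refine ⟨r, D, ?_⟩
  have h1 := tendsto_mass_deviation hw hw1
    (fun x => -Real.logb 2 (condProb (stringWeight ρ) P.kept P.record (P.kept x) (P.record x))) hδ
  have h2 := tendsto_mass_deviation hw hw1 (fun x => (keptNum P x : ℝ)) hδ
  have h3 : Tendsto (fun L : ℕ => ((2 : ℝ) ^ (-δ)) ^ L) atTop (𝓝 0) :=
    tendsto_pow_atTop_nhds_zero_of_lt_one (Real.rpow_nonneg two_pos.le _)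
      (Real.rpow_lt_one_of_one_lt_of_neg one_lt_two (by linarith))
  have hlow := ((tendsto_const_nhds (x := (1 : ℝ))).sub h1).sub h2 |>.sub h3
  simp only [sub_zero] at hlow
  refine tendsto_of_tendsto_of_tendsto_of_le_of_le' hlow tendsto_const_nhds ?_
    (Eventually.of_forall fun L => ?_)
  · filter_upwards [eventually_ge_atTop ⌈1 / δ⌉₊] with L hL
    refine le_trans ?_ (hD L)
    have hW0 : ∀ X : Fin L → ι → Label, 0 ≤ ∏ l, stringWeight ρ (X l) :=
      fun X => prod_nonneg fun l _ => hw _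
    have hLδ : 1 ≤ L * δ := by
      have := (Nat.le_ceil _).trans (Nat.cast_le (α := ℝ).2 hL)
      rwa [div_le_iff₀ hδ] at this
    have hr1 : L * (H + 2 * δ) ≤ r L := Nat.le_ceil _
    have hr2 : (r L : ℝ) < L * (H + 2 * δ) + 1 := Nat.ceil_lt_add_one (by positivity)
    refine sub_le_sub (sub_le_sub (sub_le_sub_left (mass_mono_of_pos hW0 ?_) _)
      (mass_mono hW0 ?_)) ?_
    · intro X hX0 hX
      have hX' := Set.mem_ofPred_eq.mp hX
      rw [prod_condProb_eq_rpow hw _ _ hX0] at hX'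
      have := (Real.rpow_lt_rpow_left_iff one_lt_two).1 hX'
      rw [Set.mem_ofPred_eq]
      refine lt_of_lt_of_le ?_ (le_abs_self _)
      change _ < _ - L * H
      linarith
    · intro X hX
      have hX' := Set.mem_ofPred_eq.mp hX
      rw [keptCount_eq] at hX'
      rw [Set.mem_ofPred_eq]
      refine lt_of_lt_of_le ?_ (neg_le_abs _)
      change _ < -(_ - L * E)
      have h4 : L * (y * Fintype.card ι + 4 * δ) = L * (E - H) := by rw [hδy]
      nlinarith
    · simp only [t]
      rw [one_div, ← Real.rpow_neg two_pos.le, neg_neg, ← Real.rpow_natCast 2 (r L),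
        ← Real.rpow_sub two_pos, ← Real.rpow_natCast, ← Real.rpow_mul two_pos.le]
      exact Real.rpow_le_rpow_of_exponent_le one_le_two (by nlinarith)
  · refine (successProb_eq P ρ y L (r L) (D L)).trans_le (div_le_one_of_le₀ ?_ (Nat.cast_nonneg _))
    refine (sum_le_card_nsmul _ _ 1 fun s _ => ?_).trans_eq (by simp)
    refine (mass_mono (fun X => prod_nonneg fun l _ => hw _) (Set.subset_univ _)).trans_eq ?_
    rw [mass_univ, ← Fintype.sum_pow, hw1, one_pow]

theorem le_of_mem_achievableRates (P : Protocol ι) (hw : ∀ x : ι → Label, 0 ≤ stringWeight ρ x)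
    (hw1 : ∑ x : ι → Label, stringWeight ρ x = 1) {y : ℝ} (hy : y ∈ achievableRates P ρ) :
    y * Fintype.card ι ≤ ∑ x, stringWeight ρ x * keptNum P x -
      condEntropy (stringWeight ρ) P.kept P.record := by
  set H := condEntropy (stringWeight ρ) P.kept P.record with hH
  set E := ∑ x, stringWeight ρ x * keptNum P x with hE
  by_contra! hlt
  obtain ⟨δ, hδ, hδy⟩ : ∃ δ : ℝ, 0 < δ ∧ y * Fintype.card ι = E - H + 4 * δ :=
    ⟨(y * Fintype.card ι - (E - H)) / 4, by linarith, by ring⟩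
  obtain ⟨r, D, hlim⟩ := hy
  have h1 := tendsto_mass_deviation hw hw1
    (fun x => -Real.logb 2 (condProb (stringWeight ρ) P.kept P.record (P.kept x) (P.record x))) hδ
  have h2 := tendsto_mass_deviation hw hw1 (fun x => (keptNum P x : ℝ)) hδ
  have h3 : Tendsto (fun L : ℕ => ((2 : ℝ) ^ (-δ)) ^ L) atTop (𝓝 0) :=
    tendsto_pow_atTop_nhds_zero_of_lt_one (Real.rpow_nonneg two_pos.le _)
      (Real.rpow_lt_one_of_one_lt_of_neg one_lt_two (by linarith))
  have hup := (h1.add h2).add h3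
  simp only [add_zero] at hup
  have : (1 : ℝ) ≤ 0 := by
    refine le_of_tendsto_of_tendsto' hlim hup fun L => ?_
    have hW0 : ∀ X : Fin L → ι → Label, 0 ≤ ∏ l, stringWeight ρ (X l) :=
      fun X => prod_nonneg fun l _ => hw _
    have hpow : 0 ≤ ((2 : ℝ) ^ (-δ)) ^ L := by positivity
    have h4 : L * (y * Fintype.card ι) = L * (E - H + 4 * δ) := by rw [hδy]
    have hLδ : 0 ≤ L * δ := by positivity
    -- With at most `L * (H - 2 * δ)` rounds the hash is too short to identify a typical string;
    -- with more rounds too many pairs are used up.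
    by_cases hr : (r L : ℝ) ≤ L * (H - 2 * δ)
    · refine (successProb_le P hw hw1 y L (r L) (D L)
        (t := 2 ^ (-(L * (H - δ)))) (Real.rpow_nonneg two_pos.le _)).trans ?_
      refine add_le_add (le_add_of_le_of_nonneg (mass_mono_of_pos hW0 ?_) (mass_nonneg hW0 _)) ?_
      · intro X hX0 hX
        have hX' := (Set.mem_ofPred_eq.mp hX).2
        rw [prod_condProb_eq_rpow hw _ _ hX0] at hX'
        have := (Real.rpow_lt_rpow_left_iff one_lt_two).1 hX'
        rw [Set.mem_ofPred_eq]
        refine lt_of_lt_of_le ?_ (neg_le_abs _)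
        change _ < -(_ - L * H)
        linarith
      · rw [← Real.rpow_natCast 2 (r L), ← Real.rpow_add two_pos, ← Real.rpow_natCast,
          ← Real.rpow_mul two_pos.le]
        exact Real.rpow_le_rpow_of_exponent_le one_le_two (by nlinarith)
    -- At threshold zero the guessing term disappears and only the count of remaining pairs is used.
    · refine (successProb_le P hw hw1 y L (r L) (D L) le_rfl).trans ?_
      rw [mul_zero, add_zero]
      refine le_add_of_le_of_nonneg (le_add_of_nonneg_of_le (mass_nonneg hW0 _)
        (mass_mono hW0 ?_)) hpow
      intro X hX
      have hX' := (Set.mem_ofPred_eq.mp hX).1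
      rw [keptCount_eq] at hX'
      rw [Set.mem_ofPred_eq]
      refine lt_of_lt_of_le ?_ (le_abs_self _)
      change _ < _ - L * E
      nlinarith
  linarith

/-- The yield is the expected number of pairs set aside less the conditional entropy of their
labels given the announced results, per initial pair. -/
theorem isLUB_achievableRates [Nonempty ι] (P : Protocol ι)
    (hw : ∀ x : ι → Label, 0 ≤ stringWeight ρ x)
    (hw1 : ∑ x : ι → Label, stringWeight ρ x = 1) :
    IsLUB (achievableRates P ρ) ((∑ x, stringWeight ρ x * keptNum P x -
      condEntropy (stringWeight ρ) P.kept P.record) / Fintype.card ι) := by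
  have hN : (0 : ℝ) < Fintype.card ι := by exact_mod_cast Fintype.card_pos
  refine ⟨fun y hy => (le_div_iff₀ hN).2 (le_of_mem_achievableRates P hw hw1 hy), fun u hu => ?_⟩
  refine le_of_forall_lt fun y hy => ?_
  obtain ⟨z, hz1, hz2⟩ := exists_between hy
  exact hz1.trans_le (hu (mem_achievableRates_of_lt P hw hw1 ((lt_div_iff₀ hN).1 hz2)))

theorem isLUB_protocolYield [Nonempty ι] (P : Protocol ι)
    (hw : ∀ x : ι → Label, 0 ≤ stringWeight ρ x)
    (hw1 : ∑ x : ι → Label, stringWeight ρ x = 1) :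
    IsLUB (achievableRates P ρ) (protocolYield P ρ) ∧
      protocolYield P ρ = (∑ x, stringWeight ρ x * keptNum P x -
        condEntropy (stringWeight ρ) P.kept P.record) / Fintype.card ι := by
  have h := isLUB_achievableRates P hw hw1
  have heq := h.csSup_eq h.nonempty
  exact ⟨by rw [protocolYield, heq]; exact h, heq⟩

end

/-! ### The weights of the Werner state -/

/-- The weight of a Bell state in the Werner state with fidelity `f`. -/
noncomputable def labelWeight (f : ℝ) (c : Label) : ℝ := if c = (0, 0) then f else (1 - f) / 3

theorem star_bell_dotProduct_bell (c d : Label) :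
    star (bell c) ⬝ᵥ bell d = if c = d then 1 else 0 := by
  have h2 : ((Real.sqrt 2 : ℝ) : ℂ) ^ 2 = 2 := by
    rw [← Complex.ofReal_pow, Real.sq_sqrt zero_le_two]; norm_num
  have h0 : ((Real.sqrt 2 : ℝ) : ℂ) ≠ 0 := by
    intro h; rw [h] at h2; norm_num at h2
  have hz : ∀ g : ZMod 2 → ℂ, ∑ i, g i = g 0 + g 1 := fun g => Fin.sum_univ_two g
  have e10 : (1 : ZMod 2).val = 1 := rfl
  have e11 : (1 + 1 : ZMod 2) = 0 := rfl
  have hinv : ((Real.sqrt 2 : ℝ) : ℂ)⁻¹ * ((Real.sqrt 2 : ℝ) : ℂ)⁻¹ = 1 / 2 := by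
    field_simp; rw [h2]
  obtain ⟨a, b⟩ := c
  obtain ⟨a', b'⟩ := d
  have hall : ∀ a : ZMod 2, a = 0 ∨ a = 1 := by decide
  rcases hall a with rfl | rfl <;> rcases hall b with rfl | rfl <;>
    rcases hall a' with rfl | rfl <;> rcases hall b' with rfl | rfl <;>
    simp [dotProduct, Fintype.sum_prod_type, bell, hz, e10, e11, div_eq_mul_inv, hinv] <;> norm_num

theorem bellWeight_werner (f : ℝ) (c : Label) : bellWeight (werner f) c = labelWeight f c := by
  have h : ∀ d, star (bell c) ⬝ᵥ (bellProj d).mulVec (bell c) = if c = d then 1 else 0 := by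
    intro d
    rw [bellProj, Matrix.vecMulVec_mulVec, dotProduct_smul, star_bell_dotProduct_bell,
      star_bell_dotProduct_bell]
    by_cases hcd : c = d <;> simp [hcd, eq_comm]
  simp only [bellWeight, werner, Matrix.add_mulVec, Matrix.smul_mulVec, dotProduct_add,
    dotProduct_smul, h, labelWeight]
  obtain ⟨a, b⟩ := c
  have hall : ∀ a : ZMod 2, a = 0 ∨ a = 1 := by decide
  rcases hall a with rfl | rfl <;> rcases hall b with rfl | rfl <;> simp

theorem stringWeight_werner {ι : Type} [Fintype ι] (f : ℝ) (x : ι → Label) :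
    stringWeight (werner f) x = ∏ i, labelWeight f (x i) :=
  prod_congr rfl fun i _ => bellWeight_werner f (x i)

theorem sum_label (g : Label → ℝ) : ∑ c, g c = g (0, 0) + g (0, 1) + (g (1, 0) + g (1, 1)) := by
  rw [Fintype.sum_prod_type]
  have hz : ∀ g : ZMod 2 → ℝ, ∑ i, g i = g 0 + g 1 := fun g => Fin.sum_univ_two g
  simp [hz]

theorem sum_labelWeight (f : ℝ) : ∑ c, labelWeight f c = 1 := by
  rw [sum_label]
  simp [labelWeight]
  ring

theorem labelWeight_nonneg {f : ℝ} (h0 : 0 ≤ f) (h1 : f ≤ 1) (c : Label) : 0 ≤ labelWeight f c := by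
  unfold labelWeight
  split_ifs
  · exact h0
  · linarith

/-! ### Independence -/

section Independence

/-- The product weight on strings. -/
noncomputable def prodWeight {ι α : Type*} [Fintype ι] (μ : α → ℝ) (x : ι → α) : ℝ := ∏ i, μ (x i)

theorem prodWeight_nonneg {ι α : Type*} [Fintype ι] {μ : α → ℝ} (hμ : ∀ c, 0 ≤ μ c) (x : ι → α) :
    0 ≤ prodWeight μ x :=
  prod_nonneg fun _ _ => hμ _

variable {ι α : Type*} [Fintype ι] [DecidableEq ι] [Fintype α]

variable {μ : α → ℝ}

theorem sum_prodWeight (hμ1 : ∑ c, μ c = 1) : ∑ x : ι → α, prodWeight μ x = 1 := by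
  simp only [prodWeight]
  rw [sum_pi_prod (fun _ => μ)]
  simp [hμ1]

theorem sum_prodWeight_subtype (μ : α → ℝ) (p : ι → Prop) [DecidablePred p]
    (φ : (ι → α) → ℝ) :
    ∑ x : ι → α, prodWeight μ x * φ x = ∑ u : {i // p i} → α, ∑ v : {i // ¬p i} → α,
      prodWeight μ u * prodWeight μ v * φ ((Equiv.piEquivPiSubtypeProd p fun _ => α).symm (u, v)) := by
  rw [← (Equiv.piEquivPiSubtypeProd p fun _ => α).symm.sum_comp, Fintype.sum_prod_type]
  refine sum_congr rfl fun u _ => sum_congr rfl fun v _ => ?_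
  congr 1
  rw [prodWeight, ← Fintype.prod_subtype_mul_prod_subtype p]
  congr 1
  · exact prod_congr rfl fun i _ => by simp [i.2]
  · exact prod_congr rfl fun i _ => by simp [i.2]

/-- Independence of functions of disjoint sets of coordinates, by Fubini over `A` and its
complement. -/
theorem sum_prodWeight_mul_mul (hμ1 : ∑ c, μ c = 1) {A B : Set ι} (hAB : Disjoint A B)
    {f g : (ι → α) → ℝ} (hf : DependsOn f A) (hg : DependsOn g B) :
    ∑ x, prodWeight μ x * (f x * g x) =
      (∑ x, prodWeight μ x * f x) * ∑ x, prodWeight μ x * g x := by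
  classical
  rcases isEmpty_or_nonempty α with hα | ⟨⟨c⟩⟩
  · simp at hμ1
  simp only [sum_prodWeight_subtype μ (· ∈ A)]
  set e := (Equiv.piEquivPiSubtypeProd (· ∈ A) fun _ => α).symm
  -- The letter `c` is an arbitrary filler on coordinates that the function ignores.
  have hf' : ∀ u v, f (e (u, v)) = f (e (u, fun _ => c)) := fun u v => hf fun i hi => by
    simp [e, hi]
  have hg' : ∀ u v, g (e (u, v)) = g (e (fun _ => c, v)) := fun u v => hg fun i hi => by
    simp [e, Set.disjoint_right.1 hAB hi]
  simp_rw [hf', hg']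
  have h1 : ∑ u : {i // i ∈ A} → α, prodWeight μ u = 1 := sum_prodWeight hμ1
  have h2 : ∑ v : {i // i ∉ A} → α, prodWeight μ v = 1 := sum_prodWeight hμ1
  have h3 : ∀ u : {i // i ∈ A} → α, ∑ v : {i // i ∉ A} → α,
      prodWeight μ u * prodWeight μ v * f (e (u, fun _ => c)) =
      prodWeight μ u * f (e (u, fun _ => c)) := by
    intro u
    rw [← mul_one (prodWeight μ u * f _), ← h2, mul_sum]
    exact sum_congr rfl fun v _ => by ring
  have h4 : ∑ u : {i // i ∈ A} → α, ∑ v : {i // i ∉ A} → α,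
      prodWeight μ u * prodWeight μ v * g (e (fun _ => c, v)) =
      ∑ v : {i // i ∉ A} → α, prodWeight μ v * g (e (fun _ => c, v)) := by
    simp_rw [mul_assoc, ← mul_sum]
    rw [← sum_mul, h1, one_mul]
  rw [h4]
  simp_rw [h3]
  rw [sum_mul_sum]
  exact sum_congr rfl fun u _ => sum_congr rfl fun v _ => by ring

/-- The coordinates outside the range of `e` sum to one. This transfers any block of pairs to the
standard index type `Fin K`. -/
theorem sum_prodWeight_comp (hμ1 : ∑ c, μ c = 1) {κ : Type*} [Fintype κ] [DecidableEq κ]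
    {e : κ → ι} (he : Function.Injective e) (φ : (κ → α) → ℝ) :
    ∑ x : ι → α, prodWeight μ x * φ (fun j => x (e j)) = ∑ y : κ → α, prodWeight μ y * φ y := by
  classical
  rw [sum_prodWeight_subtype μ fun i => ∃ j, e j = i]
  have h2 : ∑ v : {i // ¬∃ j, e j = i} → α, prodWeight μ v = 1 := sum_prodWeight hμ1
  have h3 : ∀ (u : {i // ∃ j, e j = i} → α) (v : {i // ¬∃ j, e j = i} → α),
      (fun j => (Equiv.piEquivPiSubtypeProd (fun i => ∃ j, e j = i) fun _ => α).symm (u, v) (e j)) =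
        fun j => u ⟨e j, j, rfl⟩ := by
    intro u v
    funext j
    exact dif_pos ⟨j, rfl⟩
  have h4 : ∀ u : {i // ∃ j, e j = i} → α, ∑ v : {i // ¬∃ j, e j = i} → α,
      prodWeight μ u * prodWeight μ v * φ (fun j => u ⟨e j, j, rfl⟩) =
        prodWeight μ u * φ (fun j => u ⟨e j, j, rfl⟩) := by
    intro u
    rw [← mul_one (prodWeight μ u * φ _), ← h2, mul_sum]
    exact sum_congr rfl fun v _ => by ring
  refine (sum_congr rfl fun u _ => (sum_congr rfl fun v _ =>
    congrArg (_ * ·) (congrArg φ (h3 u v))).trans (h4 u)).trans ?_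
  let E : κ ≃ {i // ∃ j, e j = i} := Equiv.ofInjective e he
  rw [← (Equiv.arrowCongr E (Equiv.refl α)).sum_comp]
  refine sum_congr rfl fun y _ => ?_
  congr 1
  · rw [prodWeight, ← E.prod_comp]
    simp [prodWeight]
  · congr 1
    funext j
    exact congrArg y (E.symm_apply_apply j)

end Independence

/-! ### Rules for the conditional entropy -/

section Rules

variable {Ω A B A' B' : Type*} [Fintype Ω]

theorem mass_indicator (w : Ω → ℝ) (E F : Set Ω) : mass (E.indicator w) F = mass w (F ∩ E) := by
  simp [mass, Set.indicator_indicator]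

theorem mass_congr {w : Ω → ℝ} {E F : Set Ω} (h : ∀ x, w x ≠ 0 → (x ∈ E ↔ x ∈ F)) :
    mass w E = mass w F := by
  classical
  refine sum_congr rfl fun x _ => ?_
  by_cases h0 : w x = 0
  · simp [Set.indicator_apply, h0]
  · simp [Set.indicator_apply, h x h0]

/-- Only the partitions induced by `K` and `R`, up to strings of weight zero, enter the conditional
entropy; the values and their types do not. -/
theorem condEntropy_congr {w : Ω → ℝ} {K : Ω → A} {R : Ω → B} {K' : Ω → A'} {R' : Ω → B'}
    (hK : ∀ x y, w x ≠ 0 → w y ≠ 0 → (K x = K y ↔ K' x = K' y))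
    (hR : ∀ x y, w x ≠ 0 → w y ≠ 0 → (R x = R y ↔ R' x = R' y)) :
    condEntropy w K R = condEntropy w K' R' := by
  refine sum_congr rfl fun x _ => ?_
  by_cases h0 : w x = 0
  · simp [h0]
  · rw [condProb, condProb, mass_congr (F := {y | K' y = K' x ∧ R' y = R' x}),
      mass_congr (E := {y | R y = R x}) (F := {y | R' y = R' x})]
    · exact fun y hy => hR y x hy h0
    · exact fun y hy => and_congr (hK y x hy h0) (hR y x hy h0)

/-- Membership in `E` is a function of `R`, so each fibre of `R` lies wholly inside or outside `E`,
and restriction leaves the conditional probabilities there unchanged. Unnormalized weights make the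
two parts simply add. -/
theorem condEntropy_split (w : Ω → ℝ) (K : Ω → A) (R : Ω → B) (E : Set Ω)
    (hE : ∀ x y, R x = R y → (x ∈ E ↔ y ∈ E)) :
    condEntropy w K R = condEntropy (E.indicator w) K R + condEntropy (Eᶜ.indicator w) K R := by
  have key : ∀ F : Set Ω, (∀ x y, R x = R y → (x ∈ F ↔ y ∈ F)) → ∀ x ∈ F,
      condProb (F.indicator w) K R (K x) (R x) = condProb w K R (K x) (R x) := by
    intro F hF x hx
    rw [condProb, condProb, mass_indicator, mass_indicator]
    congr 2
    · ext y
      simp only [Set.mem_inter_iff, Set.mem_ofPred_eq, and_iff_left_iff_imp, and_imp]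
      exact fun _ h => (hF y x h).2 hx
    · ext y
      simp only [Set.mem_inter_iff, Set.mem_ofPred_eq, and_iff_left_iff_imp]
      exact fun h => (hF y x h).2 hx
  have hE' : ∀ x y, R x = R y → (x ∈ Eᶜ ↔ y ∈ Eᶜ) := fun x y h => not_congr (hE x y h)
  rw [condEntropy, condEntropy, condEntropy, ← sum_add_distrib]
  refine sum_congr rfl fun x _ => ?_
  by_cases hx : x ∈ E
  · simp [hx, key E hE x hx]
  · simp [hx, key Eᶜ hE' x hx]

variable {ι α : Type*} [Fintype ι] [DecidableEq ι] [Fintype α] {μ : α → ℝ}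

theorem mass_prodWeight_inter (hμ1 : ∑ c, μ c = 1) {S T : Set ι} (hST : Disjoint S T)
    {E F : Set (ι → α)} (hE : DependsOn (· ∈ E) S) (hF : DependsOn (· ∈ F) T) :
    mass (prodWeight μ) (E ∩ F) = mass (prodWeight μ) E * mass (prodWeight μ) F := by
  classical
  have h := sum_prodWeight_mul_mul (μ := μ) hμ1 hST (f := E.indicator 1) (g := F.indicator 1)
    (fun x y hxy => by simp [Set.indicator_apply, show (x ∈ E) = (y ∈ E) from hE hxy])
    (fun x y hxy => by simp [Set.indicator_apply, show (x ∈ F) = (y ∈ F) from hF hxy])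
  have hm : ∀ G : Set (ι → α), mass (prodWeight μ) G =
      ∑ x, prodWeight μ x * G.indicator 1 x := fun G => by simp [mass, Set.indicator_apply]
  rw [hm, hm, hm, ← h]
  refine sum_congr rfl fun x _ => ?_
  by_cases h1 : x ∈ E <;> by_cases h2 : x ∈ F <;> simp [h1, h2]

/-- By independence the conditional probability factors as `p x * q x`. The logarithms add, and each
one is averaged over its own coordinates while the other event contributes its mass. -/
theorem condEntropy_prodWeight_inter (hμ : ∀ c, 0 ≤ μ c) (hμ1 : ∑ c, μ c = 1) {S T : Set ι}
    (hST : Disjoint S T) {E F : Set (ι → α)} (hE : DependsOn (· ∈ E) S)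
    (hF : DependsOn (· ∈ F) T) {K : (ι → α) → A} {K' : (ι → α) → A'} {R : (ι → α) → B}
    (hK : DependsOn K S) (hK' : DependsOn K' T) (hR : DependsOn R T) :
    condEntropy ((E ∩ F).indicator (prodWeight μ)) (fun x => (K x, K' x)) R =
      condEntropy (E.indicator (prodWeight μ)) K (fun _ => ()) * mass (prodWeight μ) F +
        mass (prodWeight μ) E * condEntropy (F.indicator (prodWeight μ)) K' R := by
  classical
  set w := prodWeight (ι := ι) μ with hw
  have hw0 : ∀ x, 0 ≤ w x := prodWeight_nonneg hμ
  have hwE : ∀ G : Set (ι → α), ∀ x, 0 ≤ G.indicator w x :=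
    fun G x => Set.indicator_nonneg (fun x _ => hw0 x) x
  set p : (ι → α) → ℝ := fun x => condProb (E.indicator w) K (fun _ => ()) (K x) () with hp
  set q : (ι → α) → ℝ := fun x => condProb (F.indicator w) K' R (K' x) (R x) with hq
  have hpq : ∀ x, condProb ((E ∩ F).indicator w) (fun x => (K x, K' x)) R (K x, K' x) (R x) =
      p x * q x := by
    intro x
    simp only [hp, hq, condProb, mass_indicator]
    rw [div_mul_div_comm, ← mass_prodWeight_inter hμ1 hST, ← mass_prodWeight_inter hμ1 hST]
    · congr 2
      · ext y; simp only [Set.mem_inter_iff, Set.mem_ofPred_eq, Prod.mk.injEq]; tauto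
      · ext y; simp only [Set.mem_inter_iff, Set.mem_ofPred_eq]; tauto
    · exact fun y z h => by simp [show (y ∈ E) = (z ∈ E) from hE h]
    · exact fun y z h => by simp [show (y ∈ F) = (z ∈ F) from hF h, hR h]
    · exact fun y z h => by simp [show (y ∈ E) = (z ∈ E) from hE h, hK h]
    · exact fun y z h => by simp [show (y ∈ F) = (z ∈ F) from hF h, hR h, hK' h]
  have hone : ∀ G : Set (ι → α), ∑ x, w x * G.indicator 1 x = mass w G := fun G => by
    simp [mass, Set.indicator_apply]
  have hsum1 : ∑ x, w x * ((E.indicator 1 x * -Real.logb 2 (p x)) * F.indicator 1 x) =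
      (∑ x, w x * (E.indicator 1 x * -Real.logb 2 (p x))) * mass w F := by
    rw [sum_prodWeight_mul_mul hμ1 hST, hone]
    · exact fun y z h => by
        simp [hp, Set.indicator_apply, show (y ∈ E) = (z ∈ E) from hE h, hK h]
    · exact fun y z h => by simp [Set.indicator_apply, show (y ∈ F) = (z ∈ F) from hF h]
  have hsum2 : ∑ x, w x * (E.indicator 1 x * (F.indicator 1 x * -Real.logb 2 (q x))) =
      mass w E * ∑ x, w x * (F.indicator 1 x * -Real.logb 2 (q x)) := by
    rw [sum_prodWeight_mul_mul hμ1 hST, hone]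
    · exact fun y z h => by simp [Set.indicator_apply, show (y ∈ E) = (z ∈ E) from hE h]
    · exact fun y z h => by
        simp [hq, Set.indicator_apply, show (y ∈ F) = (z ∈ F) from hF h, hK' h, hR h]
  have hind : ∀ (G : Set (ι → α)) x, G.indicator w x = w x * G.indicator 1 x := fun G x => by
    simp [Set.indicator_apply]
  calc _ = ∑ x, (w x * ((E.indicator 1 x * -Real.logb 2 (p x)) * F.indicator 1 x) +
          w x * (E.indicator 1 x * (F.indicator 1 x * -Real.logb 2 (q x)))) := by
        refine sum_congr rfl fun x _ => ?_
        rw [hpq]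
        by_cases h1 : x ∈ E <;> by_cases h2 : x ∈ F <;> simp [h1, h2]
        rcases (hw0 x).eq_or_lt with h0 | h0
        · simp [← h0]
        · have hp0 : p x ≠ 0 := (condProb_self_pos (hwE E) K (fun _ => ())
            (x := x) (by simpa [h1] using h0)).ne'
          have hq0 : q x ≠ 0 := (condProb_self_pos (hwE F) K' R
            (x := x) (by simpa [h2] using h0)).ne'
          rw [Real.logb_mul hp0 hq0]
          ring
    _ = _ := by
        rw [sum_add_distrib, hsum1, hsum2, condEntropy, condEntropy]
        simp only [hind, mul_assoc, hp, hq]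

end Rules

/-! ### The protocol in terms of the original labels -/

section Protocol

variable {ι : Type}

/-- The parity of the amplitude bits of the listed pairs. -/
def parity (l : List ι) (x : ι → Label) : ZMod 2 := (l.map fun i => (x i).2).sum

/-- All phase bits are shifted by that of the pair `t`. -/
def phaseShift (t : ι) (x : ι → Label) : ι → Label := fun k => ((x k).1 + (x t).1, (x k).2)

theorem parity_cons (t : ι) (R : List ι) (x : ι → Label) :
    parity (t :: R) x = (x t).2 + parity R x := by simp [parity]

theorem parity_append (l l' : List ι) (x : ι → Label) :
    parity (l ++ l') x = parity l x + parity l' x := by simp [parity]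

theorem parity_reverse (l : List ι) (x : ι → Label) : parity l.reverse x = parity l x := by
  simp [parity, List.sum_reverse]

theorem parity_congr {l : List ι} {x y : ι → Label} (h : ∀ i ∈ l, x i = y i) :
    parity l x = parity l y := by
  rw [parity, parity, List.map_congr_left fun i hi => by rw [h i hi]]

/-- The form mirrors `locate`: `t` carries the known parity, and the second half is read backwards
so that its measured pair `t'` heads the list if the search continues there. -/
theorem exists_halves {k : ℕ} {l : List ι} (hl : l.length = 2 ^ (k + 2)) :
    ∃ (t : ι) (R : List ι) (t' : ι) (R' : List ι), l = (t :: R) ++ (R'.reverse ++ [t']) ∧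
      R.length + 1 = 2 ^ (k + 1) ∧ R'.length + 1 = 2 ^ (k + 1) := by
  have h2 : 2 ^ (k + 2) = 2 ^ (k + 1) + 2 ^ (k + 1) := by ring
  have h1 : (l.take (2 ^ (k + 1))).length = 2 ^ (k + 1) := by
    rw [List.length_take]; omega
  have h3 : (l.drop (2 ^ (k + 1))).reverse.length = 2 ^ (k + 1) := by
    rw [List.length_reverse, List.length_drop]; omega
  have hpos : 0 < 2 ^ (k + 1) := by positivity
  obtain ⟨t, R, hR⟩ := List.exists_cons_of_length_pos (h1 ▸ hpos)
  obtain ⟨t', R', hR'⟩ := List.exists_cons_of_length_pos (h3 ▸ hpos)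
  refine ⟨t, R, t', R', ?_, by rw [← h1, hR]; rfl, by rw [← h3, hR']; rfl⟩
  rw [← hR, ← List.reverse_cons, ← hR', List.reverse_reverse, List.take_append_drop]

theorem locate_halves {k : ℕ} {t t' : ι} {R R' : List ι} (hR : R.length + 1 = 2 ^ (k + 1)) :
    Protocol.locate (k + 2) ((t :: R) ++ (R'.reverse ++ [t'])) =
      Protocol.checkParity R' t' fun o =>
        if o = 0 then Protocol.hash R' (Protocol.locate (k + 1) (t :: R))
        else Protocol.hash R (Protocol.locate (k + 1) (t' :: R')) := by
  have h1 : ((t :: R) ++ (R'.reverse ++ [t'])).take (2 ^ (k + 1)) = t :: R :=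
    List.take_left' (by simpa using hR)
  have h2 : (((t :: R) ++ (R'.reverse ++ [t'])).drop (2 ^ (k + 1))).reverse = t' :: R' := by
    rw [List.drop_left' (by simpa using hR)]
    simp
  rw [Protocol.locate]
  split
  · rename_i heq1 heq2
    rw [h1] at heq1
    rw [h2] at heq2
    obtain ⟨rfl, rfl⟩ := List.cons.inj heq1
    obtain ⟨rfl, rfl⟩ := List.cons.inj heq2
    rfl
  · rename_i hne
    exact absurd h2 (hne _ _ _ _ h1)

theorem nodup_halves {t t' : ι} {R R' : List ι} (h : ((t :: R) ++ (R'.reverse ++ [t'])).Nodup) :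
    (t :: R).Nodup ∧ (t' :: R').Nodup ∧ ∀ i ∈ t :: R, i ∉ t' :: R' := by
  rw [← List.reverse_cons, List.nodup_append] at h
  refine ⟨h.1, List.nodup_reverse.1 h.2.1, fun i hi hi' => h.2.2 i hi i ?_ rfl⟩
  rwa [List.mem_reverse]

theorem phaseShift_congr {t : ι} {R : List ι} {x y : ι → Label} (h : ∀ i ∈ t :: R, x i = y i)
    {i : ι} (hi : i ∈ R) : phaseShift t x i = phaseShift t y i := by
  rw [phaseShift, phaseShift, h i (by simp [hi]), h t (by simp)]

theorem dependsOn_parity (l : List ι) (o : ZMod 2) :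
    DependsOn (· ∈ {y : ι → Label | parity l y = o}) {i | i ∈ l} := fun x y h => by
  simp only [Set.mem_ofPred_eq]
  rw [parity_congr h]

variable [DecidableEq ι]

/-- The labels after `BXOR` from each pair in `R` to the pair `t`. -/
def gather (R : List ι) (t : ι) (x : ι → Label) : ι → Label := fun k =>
  if k ∈ R then ((x k).1 + (x t).1, (x k).2)
  else if k = t then ((x t).1, parity (t :: R) x) else x k

/-- `BXOR` onto `t` never changes the phase of `t`, so successive sources all gain the same phase
bit while `t` accumulates their amplitude bits. -/
theorem gather_cons {i t : ι} {R : List ι} (h : (i :: R).Nodup) (ht : t ∉ i :: R)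
    (x : ι → Label) : gather R t (bxor i t x) = gather (i :: R) t x := by
  simp only [List.nodup_cons, List.mem_cons, not_or] at h ht
  have hp : parity R (bxor i t x) = parity R x := parity_congr fun k hk => by
    have h1 : k ≠ i := fun h' => h.1 (h' ▸ hk)
    have h2 : k ≠ t := fun h' => ht.2 (h' ▸ hk)
    simp [bxor, h1, h2]
  have hti : t ≠ i := ht.1
  funext k
  by_cases hki : k = i
  · subst hki
    simp [gather, bxor, h.1, hti.symm]
  · by_cases hkt : k = t
    · subst hkt
      simp [gather, bxor, hki, ht.2, parity_cons, hp]
      ring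
    · by_cases hkR : k ∈ R <;> simp [gather, bxor, hki, hkt, hkR, hti]

theorem record_checkParity {t : ι} {R : List ι} (h : (t :: R).Nodup)
    (next : ZMod 2 → Protocol ι) (x : ι → Label) :
    (Protocol.checkParity R t next).record x =
      parity (t :: R) x :: (next (parity (t :: R) x)).record (gather R t x) := by
  induction R generalizing x with
  | nil =>
    have : gather [] t x = x := by
      funext k
      by_cases hk : k = t <;> simp [gather, hk, parity]
    simp [Protocol.checkParity, Protocol.record, this, parity]
  | cons i R ih =>
    simp only [List.nodup_cons, List.mem_cons, not_or] at h
    have h' : (t :: R).Nodup := by simp [h]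
    have hg := gather_cons (i := i) (t := t) (R := R) (by simp [h]) (by simp [h]) x
    have hp : parity (t :: R) (bxor i t x) = parity (t :: i :: R) x := by
      have := congrArg (fun z => (z t).2) hg
      simpa [gather, h] using this
    have := ih h' (bxor i t x)
    rw [hp, hg] at this
    exact this

theorem kept_checkParity {t : ι} {R : List ι} (h : (t :: R).Nodup)
    (next : ZMod 2 → Protocol ι) (x : ι → Label) :
    (Protocol.checkParity R t next).kept x =
      (next (parity (t :: R) x)).kept (gather R t x) := by
  induction R generalizing x with
  | nil =>
    have : gather [] t x = x := by
      funext k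
      by_cases hk : k = t <;> simp [gather, hk, parity]
    simp [Protocol.checkParity, Protocol.kept, this, parity]
  | cons i R ih =>
    simp only [List.nodup_cons, List.mem_cons, not_or] at h
    have h' : (t :: R).Nodup := by simp [h]
    have hg := gather_cons (i := i) (t := t) (R := R) (by simp [h]) (by simp [h]) x
    have hp : parity (t :: R) (bxor i t x) = parity (t :: i :: R) x := by
      have := congrArg (fun z => (z t).2) hg
      simpa [gather, h] using this
    have := ih h' (bxor i t x)
    rw [hp, hg] at this
    exact this

theorem gather_of_mem_of_disjoint {t' i : ι} {R' : List ι} (x : ι → Label)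
    (hi : i ∉ t' :: R') : gather R' t' x i = x i := by
  simp only [List.mem_cons, not_or] at hi
  simp [gather, hi]

/-- The search does not use the amplitude bit of the head of the list. -/
theorem locate_congr {k : ℕ} {t : ι} {R : List ι} (hn : (t :: R).Nodup)
    (hl : (t :: R).length = 2 ^ (k + 1)) {x y : ι → Label} (h : ∀ i ∈ R, x i = y i) :
    (Protocol.locate (k + 1) (t :: R)).record x = (Protocol.locate (k + 1) (t :: R)).record y ∧
      (Protocol.locate (k + 1) (t :: R)).kept x = (Protocol.locate (k + 1) (t :: R)).kept y := by
  induction k generalizing t R x y with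
  | zero => exact ⟨rfl, rfl⟩
  | succ k ih =>
    obtain ⟨u, Q, t', R', heq, hQ, hR'⟩ := exists_halves hl
    rw [heq] at hn
    obtain ⟨hn1, hn2, hdis⟩ := nodup_halves hn
    rw [heq, locate_halves hQ, record_checkParity hn2, record_checkParity hn2,
      kept_checkParity hn2, kept_checkParity hn2]
    obtain ⟨rfl, hRQ⟩ := List.cons.inj heq
    have hQm : ∀ i ∈ Q, x i = y i := fun i hi => h i (by rw [hRQ]; simp [hi])
    have hR'm : ∀ i ∈ t' :: R', x i = y i := fun i hi => h i (by
      rw [hRQ]; simp only [List.mem_cons] at hi; simp; tauto)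
    have hp : parity (t' :: R') x = parity (t' :: R') y := parity_congr hR'm
    have hg1 : ∀ i ∈ Q, gather R' t' x i = gather R' t' y i := fun i hi => by
      have := hdis i (by simp [hi])
      rw [gather_of_mem_of_disjoint x this, gather_of_mem_of_disjoint y this, hQm i hi]
    have hg2 : ∀ i ∈ R', gather R' t' x i = gather R' t' y i := fun i hi => by
      simp [gather, hi, hR'm i (by simp [hi]), hR'm t' (by simp)]
    rw [hp]
    have i1 := ih hn1 (by simpa using hQ) hg1
    have i2 := ih hn2 (by simpa using hR') hg2
    split_ifs
    · simp only [Protocol.record, Protocol.kept]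
      refine ⟨by rw [i1.1], ?_⟩
      funext i
      split_ifs with hi
      · rw [hg2 i hi]
      · rw [i1.2]
    · simp only [Protocol.record, Protocol.kept]
      refine ⟨by rw [i2.1], ?_⟩
      funext i
      split_ifs with hi
      · rw [hg1 i hi]
      · rw [i2.2]

/-- The labels of the pairs `R` set aside after a parity check on the pair `t`. -/
def blockKept (t : ι) (R : List ι) (y : ι → Label) : ι → Option Label := fun i =>
  if i ∈ R then some (phaseShift t y i) else none

theorem kept_locate_of_notMem (k : ℕ) (l : List ι) (hn : l.Nodup) (hl : l.length = 2 ^ (k + 1))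
    (x : ι → Label) {i : ι} (hi : i ∉ l) : (Protocol.locate (k + 1) l).kept x i = none := by
  induction k generalizing l x with
  | zero => rfl
  | succ k ih =>
    obtain ⟨t, R, t', R', rfl, hR, hR'⟩ := exists_halves hl
    obtain ⟨hn1, hn2, hdis⟩ := nodup_halves hn
    rw [locate_halves hR, kept_checkParity hn2]
    have h1 : i ∉ t :: R := fun h => hi (by simp at h; simp; tauto)
    have h2 : i ∉ t' :: R' := fun h => hi (by simp at h; simp; tauto)
    split_ifs
    · simp only [Protocol.kept]
      rw [if_neg (fun h => h2 (by simp [h]))]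
      exact ih _ hn1 (by simpa using hR) _ h1
    · simp only [Protocol.kept]
      rw [if_neg (fun h => h1 (by simp [h]))]
      exact ih _ hn2 (by simpa using hR') _ h2

/-- The earlier check added the phase of `t` to both the pair `i` and `t'`, so `BXOR` onto `t'`
cancels it: (a + b) + (c + b) = a + c. All trace of `t` disappears from this half. -/
theorem gather_phaseShift {t t' i : ι} {R' : List ι} (hi : i ∈ R')
    (y : ι → Label) : gather R' t' (phaseShift t y) i = phaseShift t' y i := by
  have hne : ∀ a b c : ZMod 2, a + b + (c + b) = a + c := by decide
  simp [gather, hi, phaseShift, hne]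

/-- The announced results of the search in terms of the original labels. -/
noncomputable def locateRecord (k : ℕ) (t : ι) (R : List ι) (y : ι → Label) : List (ZMod 2) :=
  (Protocol.locate k (t :: R)).record (phaseShift t y)

/-- The labels set aside by the search in terms of the original labels. -/
noncomputable def locateKept (k : ℕ) (t : ι) (R : List ι) (y : ι → Label) : ι → Option Label :=
  (Protocol.locate k (t :: R)).kept (phaseShift t y)

/-- The search is self-similar in the original labels. The half of `t` is untouched by the check on
the other half, and the half of `t'` carries the phase shift of its own measured pair. The state of
the measured pair itself does not matter, by `locate_congr`. -/
theorem locateRecord_halves {k : ℕ} {t t' : ι} {R R' : List ι}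
    (hn : ((t :: R) ++ (R'.reverse ++ [t'])).Nodup) (hR : R.length + 1 = 2 ^ (k + 1))
    (hR' : R'.length + 1 = 2 ^ (k + 1)) (y : ι → Label) :
    locateRecord (k + 2) t (R ++ (R'.reverse ++ [t'])) y = parity (t' :: R') y ::
      if parity (t' :: R') y = 0 then locateRecord (k + 1) t R y
      else locateRecord (k + 1) t' R' y := by
  obtain ⟨hn1, hn2, hdis⟩ := nodup_halves hn
  have hp : parity (t' :: R') (phaseShift t y) = parity (t' :: R') y := rfl
  rw [locateRecord, ← List.cons_append, locate_halves hR, record_checkParity hn2, hp]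
  congr 1
  split_ifs
  · exact (locate_congr hn1 (by simpa using hR) fun i hi =>
      gather_of_mem_of_disjoint _ (hdis i (by simp [hi]))).1
  · exact (locate_congr hn2 (by simpa using hR') fun i hi =>
      gather_phaseShift hi y).1

theorem locateKept_halves {k : ℕ} {t t' : ι} {R R' : List ι}
    (hn : ((t :: R) ++ (R'.reverse ++ [t'])).Nodup) (hR : R.length + 1 = 2 ^ (k + 1))
    (hR' : R'.length + 1 = 2 ^ (k + 1)) (y : ι → Label) :
    locateKept (k + 2) t (R ++ (R'.reverse ++ [t'])) y =
      if parity (t' :: R') y = 0 then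
        fun i => if i ∈ R' then blockKept t' R' y i else locateKept (k + 1) t R y i
      else fun i => if i ∈ R then blockKept t R y i else locateKept (k + 1) t' R' y i := by
  obtain ⟨hn1, hn2, hdis⟩ := nodup_halves hn
  have hp : parity (t' :: R') (phaseShift t y) = parity (t' :: R') y := rfl
  rw [locateKept, ← List.cons_append, locate_halves hR, kept_checkParity hn2, hp]
  have hg1 : ∀ i ∈ R, gather R' t' (phaseShift t y) i = phaseShift t y i := fun i hi =>
    gather_of_mem_of_disjoint _ (hdis i (by simp [hi]))
  have hg2 : ∀ i ∈ R', gather R' t' (phaseShift t y) i = phaseShift t' y i := fun i hi =>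
    gather_phaseShift hi y
  split_ifs
  · funext i
    simp only [Protocol.kept, blockKept]
    split_ifs with hi
    · rw [hg2 i hi]
    · rw [(locate_congr hn1 (by simpa using hR) hg1).2]; rfl
  · funext i
    simp only [Protocol.kept, blockKept]
    split_ifs with hi
    · rw [hg1 i hi]
    · rw [(locate_congr hn2 (by simpa using hR') hg2).2]; rfl

theorem dependsOn_locateRecord {k : ℕ} {t : ι} {R : List ι} (hn : (t :: R).Nodup)
    (hl : R.length + 1 = 2 ^ (k + 1)) :
    DependsOn (locateRecord (k + 1) t R) {i | i ∈ t :: R} := fun _ _ h =>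
  (locate_congr hn (by simpa using hl) fun _ hi => phaseShift_congr h hi).1

theorem dependsOn_locateKept {k : ℕ} {t : ι} {R : List ι} (hn : (t :: R).Nodup)
    (hl : R.length + 1 = 2 ^ (k + 1)) :
    DependsOn (locateKept (k + 1) t R) {i | i ∈ t :: R} := fun _ _ h =>
  (locate_congr hn (by simpa using hl) fun _ hi => phaseShift_congr h hi).2

theorem dependsOn_blockKept (t : ι) (R : List ι) :
    DependsOn (blockKept t R) {i | i ∈ t :: R} := fun x y h => by
  funext i
  by_cases hi : i ∈ R
  · simp only [blockKept, hi, if_true, phaseShift_congr h hi]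
  · simp [blockKept, hi]

theorem card_isSome_locateKept [Fintype ι] {k : ℕ} {t : ι} {R : List ι} (hn : (t :: R).Nodup)
    (hl : R.length + 1 = 2 ^ (k + 1)) (y : ι → Label) :
    #{i | (locateKept (k + 1) t R y i).isSome} = ∑ j ∈ Ico 1 (k + 1), (2 ^ j - 1) := by
  induction k generalizing t R with
  | zero => simp [locateKept, Protocol.locate, Protocol.kept]
  | succ k ih =>
    obtain ⟨u, Q, t', R', heq, hQ, hR'⟩ :=
      exists_halves (k := k) (l := t :: R) (by simpa using hl)
    rw [heq] at hn
    rw [List.cons_append] at heq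
    obtain ⟨rfl, rfl⟩ := List.cons.inj heq
    obtain ⟨hn1, hn2, hdis⟩ := nodup_halves hn
    -- Both outcomes at once: `B` comes from the even half and is set aside, `s :: A` is the odd
    -- half.
    have key : ∀ (s s' : ι) (A B : List ι), (s :: A).Nodup → (s' :: B).Nodup →
        A.length + 1 = 2 ^ (k + 1) → B.length + 1 = 2 ^ (k + 1) → (∀ i ∈ B, i ∉ s :: A) →
        #{i | ((if i ∈ B then blockKept s' B y i else locateKept (k + 1) s A y i)).isSome} =
          ∑ j ∈ Ico 1 (k + 1), (2 ^ j - 1) + (2 ^ (k + 1) - 1) := by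
      intro s s' A B hA hB hlA hlB hd
      have hset : ({i | ((if i ∈ B then blockKept s' B y i
          else locateKept (k + 1) s A y i)).isSome} : Finset ι) =
          ({i | (locateKept (k + 1) s A y i).isSome} : Finset ι) ∪ B.toFinset := by
        ext i
        rw [mem_union, mem_filter, mem_filter, List.mem_toFinset]
        by_cases hi : i ∈ B <;> simp [hi, blockKept]
      have hdisj : Disjoint ({i | (locateKept (k + 1) s A y i).isSome} : Finset ι) B.toFinset := by
        rw [disjoint_right]
        intro i hi
        rw [List.mem_toFinset] at hi
        have : locateKept (k + 1) s A y i = none :=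
          kept_locate_of_notMem k _ hA (by simpa using hlA) _ (hd i hi)
        simp [this]
      rw [hset, card_union_of_disjoint hdisj, ih hA hlA,
        List.toFinset_card_of_nodup (List.nodup_cons.1 hB).2]
      omega
    rw [locateKept_halves hn hQ hR', sum_Ico_succ_top (by omega)]
    split_ifs
    · exact key _ t' _ _ hn1 hn2 hQ hR' fun i hi h => hdis i h (by simp [hi])
    · exact key _ t _ _ hn2 hn1 hR' hQ fun i hi => hdis i (by simp [hi])

end Protocol

/-! ### The entropy of the labels set aside -/

section

variable {f : ℝ}

/-- The law of the string of labels of copies of the Werner state. -/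
noncomputable abbrev wernerWeight (f : ℝ) {ι : Type} [Fintype ι] : (ι → Label) → ℝ :=
  prodWeight (labelWeight f)

theorem stringWeight_werner_eq (f : ℝ) {ι : Type} [Fintype ι] :
    (stringWeight (werner f) : (ι → Label) → ℝ) = wernerWeight f :=
  funext fun x => stringWeight_werner f x

theorem parityProb_eq_mass (f : ℝ) (K : ℕ) :
    parityProb f K = mass (wernerWeight f) {x : Fin K → Label | ∑ i, (x i).2 = 0} := by
  classical
  simp [parityProb, mass, stringWeight_werner_eq, Set.indicator_apply]

/-- The weight of even strings with a given shifted string. -/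
noncomputable def shiftedWeight (f : ℝ) {m : ℕ} (v : Fin m → Label) : ℝ :=
  mass (wernerWeight f) {x : Fin (m + 1) → Label | shifted x = v ∧ ∑ i, (x i).2 = 0}

theorem S_eq (f : ℝ) (m : ℕ) :
    S f m = shannon fun v : Fin m → Label => shiftedWeight f v / parityProb f (m + 1) := by
  classical
  simp [S, shiftedWeight, mass, stringWeight_werner_eq, Set.indicator_apply]

/-- Writes the entropy as an average over label strings instead of values of the shifted string, as
in `condEntropy`. The factor `parityProb` removes the conditioning. -/
theorem parityProb_mul_S (h0 : 0 ≤ f) (h1 : f ≤ 1) (m : ℕ) :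
    parityProb f (m + 1) * S f m =
      ∑ x : Fin (m + 1) → Label, wernerWeight f x *
        if ∑ i, (x i).2 = 0 then
          -Real.logb 2 (shiftedWeight f (shifted x) / parityProb f (m + 1)) else 0 := by
  classical
  have hw : ∀ x : Fin (m + 1) → Label, 0 ≤ wernerWeight f x :=
    prodWeight_nonneg (labelWeight_nonneg h0 h1)
  have hq : ∀ v : Fin m → Label, shiftedWeight f v = ∑ x : Fin (m + 1) → Label,
      if shifted x = v then (if ∑ i, (x i).2 = 0 then wernerWeight f x else 0) else 0 := by
    intro v
    simp only [shiftedWeight, mass, Set.indicator_apply, Set.mem_ofPred_eq, ite_and]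
  have hq0 : parityProb f (m + 1) = 0 → ∀ v : Fin m → Label, shiftedWeight f v = 0 := by
    intro hp v
    rw [parityProb_eq_mass] at hp
    exact le_antisymm ((mass_mono hw fun x hx => hx.2).trans_eq hp) (mass_nonneg hw _)
  calc _ = ∑ v : Fin m → Label,
        shiftedWeight f v * -Real.logb 2 (shiftedWeight f v / parityProb f (m + 1)) := by
        rw [S_eq, shannon, mul_neg, mul_sum, ← sum_neg_distrib]
        refine sum_congr rfl fun v _ => ?_
        by_cases hp : parityProb f (m + 1) = 0
        · simp [hq0 hp v]
        · field_simp
    _ = ∑ v : Fin m → Label, ∑ x : Fin (m + 1) → Label, if shifted x = v then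
          (wernerWeight f x * if ∑ i, (x i).2 = 0 then
            -Real.logb 2 (shiftedWeight f (shifted x) / parityProb f (m + 1)) else 0) else 0 := by
        refine sum_congr rfl fun v _ => ?_
        nth_rewrite 1 [hq v]
        rw [sum_mul]
        refine sum_congr rfl fun x _ => ?_
        by_cases hx : shifted x = v
        · subst hx
          by_cases hs : ∑ i, (x i).2 = 0 <;> simp [hs]
        · simp [hx]
    _ = _ := by
        rw [sum_comm]
        simp

variable {ι : Type}

/-- An enumeration of the pairs of a block, with the head of the list last. -/
def blockIndex (t : ι) (R : List ι) : Fin (R.length + 1) → ι := Fin.snoc (α := fun _ => ι) R.get t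

theorem blockIndex_injective {t : ι} {R : List ι} (hn : (t :: R).Nodup) :
    Function.Injective (blockIndex t R) := by
  rw [List.nodup_cons] at hn
  intro i j
  refine Fin.lastCases ?_ (fun i => ?_) i <;> refine Fin.lastCases ?_ (fun j => ?_) j
  · simp
  · intro h
    simp only [blockIndex, Fin.snoc_last, Fin.snoc_castSucc] at h
    exact absurd (h ▸ List.get_mem R j) hn.1
  · intro h
    simp only [blockIndex, Fin.snoc_last, Fin.snoc_castSucc] at h
    exact absurd (h ▸ List.get_mem R i) hn.1
  · intro h
    simp only [blockIndex, Fin.snoc_castSucc] at h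
    rw [List.nodup_iff_injective_get.1 hn.2 h]

theorem sum_blockIndex (t : ι) (R : List ι) (y : ι → Label) :
    ∑ j, (y (blockIndex t R j)).2 = parity (t :: R) y := by
  rw [Fin.sum_univ_castSucc, parity_cons, add_comm]
  simp only [blockIndex, Fin.snoc_last, Fin.snoc_castSucc, parity]
  rw [← List.sum_ofFn]
  congr 2
  conv_rhs => rw [← List.ofFn_get R, List.map_ofFn]
  rfl

variable [DecidableEq ι]

theorem blockKept_eq_iff {t : ι} {R : List ι} (x y : ι → Label) :
    blockKept t R x = blockKept t R y ↔
      shifted (fun j => x (blockIndex t R j)) = shifted fun j => y (blockIndex t R j) := by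
  simp only [funext_iff, shifted, blockIndex, Fin.snoc_last, Fin.snoc_castSucc]
  constructor
  · intro h i
    have := h (R.get i)
    simpa [blockKept, phaseShift] using this
  · intro h i
    by_cases hi : i ∈ R
    · obtain ⟨j, rfl⟩ := List.mem_iff_get.1 hi
      have := h j
      simp only [blockKept, hi, if_true, phaseShift]
      rw [this]
    · simp [blockKept, hi]

variable [Fintype ι]

theorem mass_block (f : ℝ) {t : ι} {R : List ι} (hn : (t :: R).Nodup)
    (E : Set (Fin (R.length + 1) → Label)) :
    mass (wernerWeight f) {y : ι → Label | (fun j => y (blockIndex t R j)) ∈ E} =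
      mass (wernerWeight f) E := by
  classical
  have := sum_prodWeight_comp (sum_labelWeight f) (blockIndex_injective hn)
    fun x => if x ∈ E then 1 else 0
  simpa [mass, Set.indicator_apply] using this

theorem mass_even (f : ℝ) {t : ι} {R : List ι} (hn : (t :: R).Nodup) :
    mass (wernerWeight f) {y : ι → Label | parity (t :: R) y = 0} =
      parityProb f (R.length + 1) := by
  rw [parityProb_eq_mass, ← mass_block f hn]
  congr 1
  ext y
  simp [sum_blockIndex]

theorem mass_odd (f : ℝ) {t : ι} {R : List ι} (hn : (t :: R).Nodup) :
    mass (wernerWeight f) {y : ι → Label | parity (t :: R) y = 1} =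
      1 - parityProb f (R.length + 1) := by
  rw [← mass_even f hn, eq_sub_iff_add_eq, add_comm]
  have h := mass_add_mass_compl (wernerWeight f) {y : ι → Label | parity (t :: R) y = 0}
  rw [sum_prodWeight (sum_labelWeight f)] at h
  rw [← h]
  congr 2
  ext y
  simp only [Set.mem_ofPred_eq, Set.mem_compl_iff]
  generalize parity (t :: R) y = a
  revert a
  decide

theorem condEntropy_block (h0 : 0 ≤ f) (h1 : f ≤ 1) {t : ι} {R : List ι} (hn : (t :: R).Nodup) :
    condEntropy ({y : ι → Label | parity (t :: R) y = 0}.indicator (wernerWeight f))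
      (blockKept t R) (fun _ => ()) = parityProb f (R.length + 1) * S f R.length := by
  classical
  rw [parityProb_mul_S h0 h1, ← sum_prodWeight_comp (sum_labelWeight f) (blockIndex_injective hn)]
  refine sum_congr rfl fun y _ => ?_
  rw [sum_blockIndex]
  by_cases hy : parity (t :: R) y = 0
  · rw [Set.indicator_of_mem (show y ∈ {y : ι → Label | parity (t :: R) y = 0} from hy), if_pos hy, condProb, mass_indicator, mass_indicator,
      shiftedWeight, ← mass_block f hn, ← mass_even f hn]
    congr 4
    · congr 1
      ext z
      simp [blockKept_eq_iff, sum_blockIndex]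
    · congr 1
      ext z
      simp
  · rw [Set.indicator_of_notMem (show y ∉ {y : ι → Label | parity (t :: R) y = 0} from hy), if_neg hy]
    simp

/-- One step of the search with even half `t :: B` and odd half `s :: A`. These are disjoint sets of
coordinates, so the entropy of the labels set aside at once adds to that of the rest of the search.
-/
theorem condEntropy_hash (h0 : 0 ≤ f) (h1 : f ≤ 1) {k : ℕ} {s t : ι} {A B : List ι}
    (hA : (s :: A).Nodup) (hB : (t :: B).Nodup) (hlA : A.length + 1 = 2 ^ (k + 1))
    (hdis : ∀ i ∈ t :: B, i ∉ s :: A) :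
    condEntropy (({y : ι → Label | parity (t :: B) y = 0} ∩
        {y | parity (s :: A) y = 1}).indicator (wernerWeight f))
      (fun y i => if i ∈ B then blockKept t B y i else locateKept (k + 1) s A y i)
      (locateRecord (k + 1) s A) =
    parityProb f (B.length + 1) * S f B.length * (1 - parityProb f (A.length + 1)) +
      parityProb f (B.length + 1) * condEntropy
        ({y : ι → Label | parity (s :: A) y = 1}.indicator (wernerWeight f))
        (locateKept (k + 1) s A) (locateRecord (k + 1) s A) := by
  rw [← condEntropy_block h0 h1 hB, ← mass_even f hB, ← mass_odd f hA,
    ← condEntropy_prodWeight_inter (labelWeight_nonneg h0 h1) (sum_labelWeight f)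
      (S := {i | i ∈ t :: B}) (T := {i | i ∈ s :: A}) (Set.disjoint_left.2 hdis)
      (dependsOn_parity _ _) (dependsOn_parity _ _) (dependsOn_blockKept t B)
      (dependsOn_locateKept hA hlA) (dependsOn_locateRecord hA hlA)]
  -- The merged function carries the same information as the pair, because the two parts are never
  -- both different from `none` at the same index.
  refine condEntropy_congr (fun x y _ _ => ?_) fun _ _ _ _ => Iff.rfl
  rw [Prod.mk.injEq, funext_iff, funext_iff, funext_iff, ← forall_and]
  refine forall_congr' fun i => ?_
  by_cases hi : i ∈ B
  · have hn : ∀ z : ι → Label, locateKept (k + 1) s A z i = none := fun z =>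
      kept_locate_of_notMem k _ hA (by simpa using hlA) _ (hdis i (by simp [hi]))
    simp [hi, hn]
  · simp [hi, blockKept]

theorem condEntropy_locate (h0 : 0 ≤ f) (h1 : f ≤ 1) {k : ℕ} {t : ι} {R : List ι}
    (hn : (t :: R).Nodup) (hl : R.length + 1 = 2 ^ (k + 1)) :
    condEntropy ({y : ι → Label | parity (t :: R) y = 1}.indicator (wernerWeight f))
      (locateKept (k + 1) t R) (locateRecord (k + 1) t R) =
    (1 - parityProb f (2 ^ (k + 1))) * ∑ j ∈ Ico 1 (k + 1), S f (2 ^ j - 1) := by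
  induction k generalizing t R with
  | zero =>
    simp only [condEntropy, zero_add, Ico_self, sum_empty, mul_zero]
    refine sum_eq_zero fun x _ => ?_
    -- In a block of two pairs nothing is kept or announced, so the conditional probability is 0/0 =
    -- 0 or 1; its logarithm is zero either way.
    have : condProb ({y : ι → Label | parity (t :: R) y = 1}.indicator (wernerWeight f))
        (locateKept 1 t R) (locateRecord 1 t R) (locateKept 1 t R x) (locateRecord 1 t R x) = 0 ∨
      condProb ({y : ι → Label | parity (t :: R) y = 1}.indicator (wernerWeight f))
        (locateKept 1 t R) (locateRecord 1 t R) (locateKept 1 t R x) (locateRecord 1 t R x) = 1 := by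
      simp [condProb, locateKept, locateRecord, Protocol.locate, Protocol.kept, Protocol.record,
        div_self_eq_one₀]
      exact em _
    rcases this with h | h <;> simp [h]
  | succ k ih =>
    obtain ⟨u, Q, t', R', heq, hQ, hR'⟩ :=
      exists_halves (k := k) (l := t :: R) (by simpa using hl)
    rw [heq] at hn
    rw [List.cons_append] at heq
    obtain ⟨rfl, rfl⟩ := List.cons.inj heq
    obtain ⟨hn1, hn2, hdis⟩ := nodup_halves hn
    set w : (ι → Label) → ℝ := wernerWeight f
    have hpar : ∀ y : ι → Label, parity (t :: (Q ++ (R'.reverse ++ [t']))) y =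
        parity (t :: Q) y + parity (t' :: R') y := by
      intro y
      rw [← List.cons_append, parity_append, ← List.reverse_cons, parity_reverse]
    set E : Set (ι → Label) := {y | parity (t :: (Q ++ (R'.reverse ++ [t']))) y = 1} with hE
    set O : Set (ι → Label) := {y | parity (t' :: R') y = 0} with hO
    have hO1 : O ∩ E = {y | parity (t' :: R') y = 0} ∩ {y | parity (t :: Q) y = 1} := by
      ext y
      simp only [hE, hO, Set.mem_inter_iff, Set.mem_ofPred_eq, hpar]
      generalize parity (t :: Q) y = a
      generalize parity (t' :: R') y = b
      revert a b
      decide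
    have hO2 : Oᶜ ∩ E = {y | parity (t :: Q) y = 0} ∩ {y | parity (t' :: R') y = 1} := by
      ext y
      simp only [hE, hO, Set.mem_inter_iff, Set.mem_ofPred_eq, Set.mem_compl_iff, hpar]
      generalize parity (t :: Q) y = a
      generalize parity (t' :: R') y = b
      revert a b
      decide
    have hrec := locateRecord_halves hn hQ hR'
    have hkept := locateKept_halves hn hQ hR'
    have hmass : mass w E = 1 - parityProb f (2 ^ (k + 2)) := by
      have hlen : (Q ++ (R'.reverse ++ [t'])).length + 1 = 2 ^ (k + 2) := by simpa using hl
      rw [← hlen, hE]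
      exact mass_odd f hn
    -- The two outcomes exhaust `E`: with K = 2^(k+1) this says that 1 − p_{2K} = 2 p_K (1 − p_K),
    -- which collects the two contributions at the end.
    have hm1 : mass w (E ∩ O) + mass w (E \ O) = mass w E := mass_inter_add_mass_diff w E O
    rw [Set.inter_comm, hO1, Set.sdiff_eq, Set.inter_comm E, hO2,
      mass_prodWeight_inter (sum_labelWeight f) (Set.disjoint_left.2 fun i hi hi' => hdis i hi' hi)
        (dependsOn_parity _ _) (dependsOn_parity _ _),
      mass_prodWeight_inter (sum_labelWeight f) (Set.disjoint_left.2 hdis)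
        (dependsOn_parity _ _) (dependsOn_parity _ _), mass_even f hn1, mass_even f hn2,
      mass_odd f hn1, mass_odd f hn2, hmass, hQ, hR'] at hm1
    have c1 := condEntropy_hash h0 h1 hn1 hn2 hQ fun i hi hi' => hdis i hi' hi
    have c2 := condEntropy_hash h0 h1 hn2 hn1 hR' hdis
    rw [ih hn1 hQ, hQ, hR'] at c1
    rw [ih hn2 hR', hQ, hR'] at c2
    rw [condEntropy_split _ _ _ O (fun x y hxy => by
      rw [hrec, hrec] at hxy
      have := (List.cons.inj hxy).1
      simp only [hO, Set.mem_ofPred_eq, this]), Set.indicator_indicator, Set.indicator_indicator,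
      hO1, hO2]
    have e1 : condEntropy (({y : ι → Label | parity (t' :: R') y = 0} ∩
        {y | parity (t :: Q) y = 1}).indicator w)
        (locateKept (k + 2) t (Q ++ (R'.reverse ++ [t'])))
        (locateRecord (k + 2) t (Q ++ (R'.reverse ++ [t']))) = _ :=
      (condEntropy_congr (fun x y hx hy => by
        have hx' := (Set.mem_of_indicator_ne_zero hx).1
        have hy' := (Set.mem_of_indicator_ne_zero hy).1
        rw [Set.mem_ofPred_eq] at hx' hy'
        rw [hkept, hkept, if_pos hx', if_pos hy']) fun x y hx hy => by
        have hx' := (Set.mem_of_indicator_ne_zero hx).1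
        have hy' := (Set.mem_of_indicator_ne_zero hy).1
        rw [Set.mem_ofPred_eq] at hx' hy'
        rw [hrec, hrec, if_pos hx', if_pos hy', hx', hy', List.cons.injEq]
        simp).trans c1
    have e2 : condEntropy (({y : ι → Label | parity (t :: Q) y = 0} ∩
        {y | parity (t' :: R') y = 1}).indicator w)
        (locateKept (k + 2) t (Q ++ (R'.reverse ++ [t'])))
        (locateRecord (k + 2) t (Q ++ (R'.reverse ++ [t']))) = _ :=
      (condEntropy_congr (fun x y hx hy => by
        have hx' := (Set.mem_of_indicator_ne_zero hx).2
        have hy' := (Set.mem_of_indicator_ne_zero hy).2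
        rw [Set.mem_ofPred_eq] at hx' hy'
        rw [hkept, hkept, hx', hy', if_neg one_ne_zero, if_neg one_ne_zero]) fun x y hx hy => by
        have hx' := (Set.mem_of_indicator_ne_zero hx).2
        have hy' := (Set.mem_of_indicator_ne_zero hy).2
        rw [Set.mem_ofPred_eq] at hx' hy'
        rw [hrec, hrec, hx', hy', if_neg one_ne_zero, if_neg one_ne_zero, List.cons.injEq]
        simp).trans c2
    rw [e1, e2, sum_Ico_succ_top (Nat.le_add_left 1 k), ← hm1]
    have g1 : Q.length = 2 ^ (k + 1) - 1 := by omega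
    have g2 : R'.length = 2 ^ (k + 1) - 1 := by omega
    rw [g1, g2]
    ring

end

/-! ### The yields -/

section

variable {f : ℝ}

theorem aepp_eq {n : ℕ} {t : Fin (2 ^ n)} {R : List (Fin (2 ^ n))}
    (h : (List.finRange (2 ^ n)).reverse = t :: R) :
    aepp n = Protocol.checkParity R t fun o =>
      if o = 0 then Protocol.hash R Protocol.done else Protocol.locate n (t :: R) := by
  rw [aepp]
  split
  · rename_i heq
    rw [h] at heq
    obtain ⟨rfl, rfl⟩ := List.cons.inj heq
    rfl
  · rename_i heq
    simp [h] at heq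

theorem record_aepp {k : ℕ} {t : Fin (2 ^ (k + 1))} {R : List (Fin (2 ^ (k + 1)))}
    (h : (List.finRange (2 ^ (k + 1))).reverse = t :: R) (hn : (t :: R).Nodup)
    (hl : R.length + 1 = 2 ^ (k + 1)) (y : Fin (2 ^ (k + 1)) → Label) :
    (aepp (k + 1)).record y = parity (t :: R) y ::
      if parity (t :: R) y = 0 then [] else locateRecord (k + 1) t R y := by
  rw [aepp_eq h, record_checkParity hn]
  congr 1
  split_ifs
  · rfl
  · exact (locate_congr hn (by simpa using hl) fun i hi => by simp [gather, hi, phaseShift]).1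

theorem kept_aepp {k : ℕ} {t : Fin (2 ^ (k + 1))} {R : List (Fin (2 ^ (k + 1)))}
    (h : (List.finRange (2 ^ (k + 1))).reverse = t :: R) (hn : (t :: R).Nodup)
    (hl : R.length + 1 = 2 ^ (k + 1)) (y : Fin (2 ^ (k + 1)) → Label) :
    (aepp (k + 1)).kept y =
      if parity (t :: R) y = 0 then blockKept t R y else locateKept (k + 1) t R y := by
  rw [aepp_eq h, kept_checkParity hn]
  split_ifs
  · funext i
    by_cases hi : i ∈ R <;> simp [Protocol.kept, blockKept, hi, gather, phaseShift]
  · exact (locate_congr hn (by simpa using hl) fun i hi => by simp [gather, hi, phaseShift]).2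

theorem exists_reverse_finRange (k : ℕ) : ∃ (t : Fin (2 ^ (k + 1))) (R : List (Fin (2 ^ (k + 1)))),
    (List.finRange (2 ^ (k + 1))).reverse = t :: R ∧ (t :: R).Nodup ∧
      R.length + 1 = 2 ^ (k + 1) := by
  have hlen : (List.finRange (2 ^ (k + 1))).reverse.length = 2 ^ (k + 1) := by simp
  have hpos : 0 < 2 ^ (k + 1) := by positivity
  obtain ⟨t, R, h⟩ := List.exists_cons_of_length_pos (hlen ▸ hpos)
  refine ⟨t, R, h, ?_, ?_⟩
  · rw [← h]
    exact List.nodup_reverse.2 (List.nodup_finRange _)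
  · rw [h] at hlen
    exact hlen

theorem condEntropy_aepp (h0 : 0 ≤ f) (h1 : f ≤ 1) (k : ℕ) :
    condEntropy (wernerWeight f) (aepp (k + 1)).kept (aepp (k + 1)).record =
      parityProb f (2 ^ (k + 1)) * S f (2 ^ (k + 1) - 1) +
        (1 - parityProb f (2 ^ (k + 1))) * ∑ j ∈ Ico 1 (k + 1), S f (2 ^ j - 1) := by
  obtain ⟨t, R, h, hn, hl⟩ := exists_reverse_finRange k
  have hrec := record_aepp h hn hl
  have hkept := kept_aepp h hn hl
  set O : Set (Fin (2 ^ (k + 1)) → Label) := {y | parity (t :: R) y = 0} with hO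
  have hOc : Oᶜ = {y | parity (t :: R) y = 1} := by
    ext y
    simp only [hO, Set.mem_ofPred_eq, Set.mem_compl_iff]
    generalize parity (t :: R) y = a
    revert a
    decide
  rw [condEntropy_split _ _ _ O (fun x y hxy => by
    rw [hrec, hrec] at hxy
    have := (List.cons.inj hxy).1
    simp only [hO, Set.mem_ofPred_eq, this]), hOc, ← condEntropy_locate h0 h1 hn hl]
  have hR : R.length = 2 ^ (k + 1) - 1 := by omega
  have hblock := condEntropy_block h0 h1 hn
  rw [hl] at hblock
  rw [← hR, ← hblock]
  congr 1
  · refine condEntropy_congr (fun x y hx hy => ?_) fun x y hx hy => ?_ <;>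
      have hx' := Set.mem_of_indicator_ne_zero hx <;>
      have hy' := Set.mem_of_indicator_ne_zero hy <;>
      rw [hO, Set.mem_ofPred_eq] at hx' hy'
    · rw [hkept, hkept, if_pos hx', if_pos hy']
    · rw [hrec, hrec, if_pos hx', if_pos hy', hx', hy']
      simp
  · refine condEntropy_congr (fun x y hx hy => ?_) fun x y hx hy => ?_ <;>
      have hx' := Set.mem_of_indicator_ne_zero hx <;>
      have hy' := Set.mem_of_indicator_ne_zero hy <;>
      rw [Set.mem_ofPred_eq] at hx' hy'
    · rw [hkept, hkept, hx', hy', if_neg one_ne_zero, if_neg one_ne_zero]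
    · rw [hrec, hrec, hx', hy', if_neg one_ne_zero, if_neg one_ne_zero, List.cons.injEq]
      simp

theorem sum_Ico_two_pow_sub_one (k : ℕ) :
    ((∑ j ∈ Ico 1 (k + 1), (2 ^ j - 1) : ℕ) : ℝ) = 2 ^ (k + 1) - (k + 1) - 1 := by
  induction k with
  | zero => norm_num
  | succ k ih =>
    rw [sum_Ico_succ_top (Nat.le_add_left 1 k), Nat.cast_add, ih, Nat.cast_sub Nat.one_le_two_pow]
    push_cast
    ring

theorem sum_keptNum_aepp (f : ℝ) (k : ℕ) :
    ∑ y, wernerWeight f y * keptNum (aepp (k + 1)) y =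
      parityProb f (2 ^ (k + 1)) * (2 ^ (k + 1) - 1) +
        (1 - parityProb f (2 ^ (k + 1))) * (2 ^ (k + 1) - (k + 1) - 1) := by
  classical
  obtain ⟨t, R, h, hn, hl⟩ := exists_reverse_finRange k
  have hkept := kept_aepp h hn hl
  set O : Set (Fin (2 ^ (k + 1)) → Label) := {y | parity (t :: R) y = 0} with hO
  have hnum : ∀ y, wernerWeight f y * keptNum (aepp (k + 1)) y =
      O.indicator (wernerWeight f) y * (2 ^ (k + 1) - 1) +
        Oᶜ.indicator (wernerWeight f) y * (2 ^ (k + 1) - (k + 1) - 1) := by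
    intro y
    rw [keptNum, hkept]
    by_cases hy : parity (t :: R) y = 0
    · have hc : #{i | (blockKept t R y i).isSome} = R.length := by
        rw [← List.toFinset_card_of_nodup (List.nodup_cons.1 hn).2]
        congr 1
        ext i
        rw [mem_filter, List.mem_toFinset]
        by_cases hi : i ∈ R <;> simp [blockKept, hi]
      have hR : (R.length : ℝ) = 2 ^ (k + 1) - 1 := by
        rw [eq_sub_iff_add_eq]
        exact_mod_cast hl
      have hyO : y ∈ O := hy
      rw [if_pos hy, hc, hR, Set.indicator_of_mem hyO,
        Set.indicator_of_notMem (Set.notMem_compl_iff.2 hyO)]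
      ring
    · have hyO : y ∉ O := hy
      rw [if_neg hy, card_isSome_locateKept hn hl, sum_Ico_two_pow_sub_one,
        Set.indicator_of_notMem hyO, Set.indicator_of_mem (Set.mem_compl hyO)]
      ring
  simp_rw [hnum]
  rw [sum_add_distrib, ← sum_mul, ← sum_mul]
  have e1 : ∑ y, O.indicator (wernerWeight f) y = parityProb f (2 ^ (k + 1)) := by
    have := mass_even f hn
    rwa [hl] at this
  have e2 : ∑ y, Oᶜ.indicator (wernerWeight f) y = 1 - parityProb f (2 ^ (k + 1)) := by
    have := mass_add_mass_compl (wernerWeight f) O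
    rw [sum_prodWeight (sum_labelWeight f), mass, e1] at this
    exact eq_sub_of_add_eq' this
  rw [e1, e2]

/-- The numbers of pairs set aside, N − 1 and N − n − 1, average to N − p − (1−p)(n+1), the source
of the terms 1 and n + 1; the `S` terms are the conditional entropy. -/
theorem yield_aepp (h0 : 0 ≤ f) (h1 : f ≤ 1) {n : ℕ} (hn : 1 ≤ n) :
    IsLUB (achievableRates (aepp n) (werner f)) (protocolYield (aepp n) (werner f)) ∧
      protocolYield (aepp n) (werner f) =
        1 - parityProb f (2 ^ n) / (2 : ℝ) ^ n * (1 + S f (2 ^ n - 1))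
          - (1 - parityProb f (2 ^ n)) / (2 : ℝ) ^ n *
              ((n : ℝ) + 1 + ∑ k ∈ Ico 1 n, S f (2 ^ k - 1)) := by
  obtain ⟨k, rfl⟩ : ∃ k, n = k + 1 := ⟨n - 1, by omega⟩
  have hw := stringWeight_werner_eq f (ι := Fin (2 ^ (k + 1)))
  obtain ⟨hl, hv⟩ := isLUB_protocolYield (ρ := werner f) (aepp (k + 1))
    (by rw [hw]; exact prodWeight_nonneg (labelWeight_nonneg h0 h1))
    (by rw [hw]; exact sum_prodWeight (sum_labelWeight f))
  refine ⟨hl, ?_⟩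
  rw [hv, hw, condEntropy_aepp h0 h1, sum_keptNum_aepp, Fintype.card_fin]
  push_cast
  field_simp
  ring

theorem shannon_werner (f : ℝ) :
    shannon ![f, (1 - f) / 3, (1 - f) / 3, (1 - f) / 3] =
      ∑ c, labelWeight f c * -Real.logb 2 (labelWeight f c) := by
  rw [sum_label]
  simp [shannon, Fin.sum_univ_succ, labelWeight]
  ring

theorem yield_universalHashing (h0 : 0 ≤ f) (h1 : f ≤ 1) :
    IsLUB (achievableRates universalHashing (werner f))
        (protocolYield universalHashing (werner f)) ∧
      protocolYield universalHashing (werner f) =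
        1 - shannon ![f, (1 - f) / 3, (1 - f) / 3, (1 - f) / 3] := by
  classical
  have hw := stringWeight_werner_eq f (ι := Fin 1)
  obtain ⟨hl, hv⟩ := isLUB_protocolYield (ρ := werner f) universalHashing
    (by rw [hw]; exact prodWeight_nonneg (labelWeight_nonneg h0 h1))
    (by rw [hw]; exact sum_prodWeight (sum_labelWeight f))
  refine ⟨hl, ?_⟩
  have hkept : ∀ y : Fin 1 → Label, universalHashing.kept y = fun _ => some (y 0) := by
    intro y
    funext i
    rw [Subsingleton.elim i 0]
    simp [universalHashing, Protocol.kept]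
  have hnum : ∀ y, keptNum universalHashing y = 1 := fun y => by simp [keptNum, hkept]
  have hs := sum_prodWeight (ι := Fin 1) (sum_labelWeight f)
  rw [hv, hw, Fintype.card_fin, shannon_werner]
  simp only [hnum, Nat.cast_one, mul_one, hs, div_one]
  congr 1
  rw [condEntropy, ← (Equiv.funUnique (Fin 1) Label).symm.sum_comp]
  refine sum_congr rfl fun c _ => ?_
  have hprod : ∀ y : Fin 1 → Label, wernerWeight f y = labelWeight f (y 0) := fun y => by
    simp [prodWeight]
  have e1 : mass (wernerWeight f) {x : Fin 1 → Label | universalHashing.kept x =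
      universalHashing.kept ((Equiv.funUnique (Fin 1) Label).symm c) ∧
      universalHashing.record x =
        universalHashing.record ((Equiv.funUnique (Fin 1) Label).symm c)} = labelWeight f c := by
    rw [mass, ← (Equiv.funUnique (Fin 1) Label).symm.sum_comp, sum_eq_single c]
    · rw [Set.indicator_of_mem (by simp), hprod]
      rfl
    · intro b _ hb
      rw [Set.indicator_of_notMem]
      simp only [Set.mem_ofPred_eq, hkept, not_and]
      intro h
      exact absurd (Option.some.inj (congrFun h 0)) hb
    · simp
  have e2 : mass (wernerWeight f) {x : Fin 1 → Label | universalHashing.record x =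
        universalHashing.record ((Equiv.funUnique (Fin 1) Label).symm c)} = 1 := by
    rw [← hs, ← mass_univ]
    congr 1
    ext x
    simp [universalHashing, Protocol.record]
  rw [condProb, e1, e2, div_one, hprod]
  rfl

end

/-! ### Entropies of even and odd strings -/

section

/-- The eigenvalue of the label distribution at the character `(-1)^b`. -/
noncomputable def bias (f : ℝ) : ℝ := (4 * f - 1) / 3

/-- The sign `(-1)^b` of a label. -/
noncomputable def ampSign (c : Label) : ℝ := if c.2 = 0 then 1 else -1

theorem prod_ampSign {ι : Type*} (s : Finset ι) (x : ι → Label) :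
    ∏ i ∈ s, ampSign (x i) = if ∑ i ∈ s, (x i).2 = 0 then 1 else -1 := by
  classical
  have key : ∀ a b : ZMod 2, (if a = 0 then (1 : ℝ) else -1) * (if b = 0 then 1 else -1) =
      if a + b = 0 then 1 else -1 := by
    have hall : ∀ a : ZMod 2, a = 0 ∨ a = 1 := by decide
    have e11 : (1 + 1 : ZMod 2) = 0 := rfl
    intro a b
    rcases hall a with rfl | rfl <;> rcases hall b with rfl | rfl <;> simp [e11]
  induction s using Finset.induction_on with
  | empty => simp
  | insert i s hi ih => rw [prod_insert hi, sum_insert hi, ih, ampSign, key]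

/-- Expansion in the characters of the parity turns the parity condition into product functions,
whose sums factor over the pairs. -/
theorem even_indicator {K : ℕ} (x : Fin K → Label) :
    (if ∑ i, (x i).2 = 0 then (1 : ℝ) else 0) = (1 + ∏ i, ampSign (x i)) / 2 := by
  rw [prod_ampSign]
  split_ifs <;> norm_num

theorem sum_labelWeight_mul_ampSign (f : ℝ) : ∑ c, labelWeight f c * ampSign c = bias f := by
  rw [sum_label]
  simp [labelWeight, ampSign, bias]
  ring

theorem parityProb_eq (f : ℝ) (K : ℕ) : parityProb f K = (1 + bias f ^ K) / 2 := by
  have h : ∀ x : Fin K → Label, (if ∑ i, (x i).2 = 0 then stringWeight (werner f) x else 0) =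
      (∏ i, labelWeight f (x i) + ∏ i, (labelWeight f (x i) * ampSign (x i))) / 2 := by
    intro x
    rw [← mul_boole, even_indicator, stringWeight_werner, prod_mul_distrib]
    ring
  simp only [parityProb, h]
  rw [← sum_div, sum_add_distrib, ← Fintype.sum_pow, sum_labelWeight, one_pow,
    ← Fintype.sum_pow (fun c => labelWeight f c * ampSign c), sum_labelWeight_mul_ampSign]

/-- The entropy of one label. -/
noncomputable def labelEntropy (f : ℝ) : ℝ := ∑ c, labelWeight f c * -Real.logb 2 (labelWeight f c)

/-- The information content of a label averaged with the sign `(-1)^b`. -/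
noncomputable def signedEntropy (f : ℝ) : ℝ :=
  ∑ c, labelWeight f c * ampSign c * -Real.logb 2 (labelWeight f c)

variable {f : ℝ}

theorem labelWeight_pos (h0 : 0 < f) (h1 : f < 1) (c : Label) : 0 < labelWeight f c := by
  unfold labelWeight
  split_ifs
  · exact h0
  · linarith

theorem sum_even_mul_log (h0 : 0 < f) (h1 : f < 1) (K : ℕ) :
    (∑ x : Fin K → Label, wernerWeight f x *
      if ∑ i, (x i).2 = 0 then -Real.logb 2 (wernerWeight f x) else 0) =
      (K * labelEntropy f + K * bias f ^ (K - 1) * signedEntropy f) / 2 := by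
  have h : ∀ x : Fin K → Label, (wernerWeight f x *
      if ∑ i, (x i).2 = 0 then -Real.logb 2 (wernerWeight f x) else 0) =
      ((∏ i, labelWeight f (x i)) * ∑ i, -Real.logb 2 (labelWeight f (x i)) +
        (∏ i, labelWeight f (x i) * ampSign (x i)) * ∑ i, -Real.logb 2 (labelWeight f (x i))) /
        2 := by
    intro x
    have hl : -Real.logb 2 (wernerWeight f x) = ∑ i, -Real.logb 2 (labelWeight f (x i)) := by
      simp only [prodWeight, Real.logb]
      rw [Real.log_prod fun i _ => (labelWeight_pos h0 h1 _).ne', sum_div, sum_neg_distrib]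
    have hW : wernerWeight f x = ∏ i, labelWeight f (x i) := rfl
    rw [hl, ← mul_boole, even_indicator, hW, prod_mul_distrib]
    ring
  simp only [h]
  rw [← sum_div, sum_add_distrib, sum_prod_mul_sum (labelWeight f)
    fun c => -Real.logb 2 (labelWeight f c), sum_prod_mul_sum
    (fun c => labelWeight f c * ampSign c) fun c => -Real.logb 2 (labelWeight f c), sum_labelWeight, sum_labelWeight_mul_ampSign,
    one_pow, mul_one]
  rfl

/-- The entropy of `K` labels given even parity. -/
noncomputable def evenEntropy (f : ℝ) (K : ℕ) : ℝ :=
  (K * labelEntropy f + K * bias f ^ (K - 1) * signedEntropy f) / 2 / parityProb f K +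
    Real.logb 2 (parityProb f K)

/-- The entropy of `K` labels given odd parity. -/
noncomputable def oddEntropy (f : ℝ) (K : ℕ) : ℝ :=
  (K * labelEntropy f - K * bias f ^ (K - 1) * signedEntropy f) / 2 / (1 - parityProb f K) +
    Real.logb 2 (1 - parityProb f K)

theorem parityProb_pos (h0 : 0 < f) (h1 : f < 1) {K : ℕ} (hK : K ≠ 0) : 0 < parityProb f K := by
  have hb : |bias f| < 1 := by
    rw [bias, abs_lt]
    constructor <;> linarith
  have h : |bias f ^ K| < 1 := by
    rw [abs_pow]
    exact pow_lt_one₀ (abs_nonneg _) hb hK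
  rw [parityProb_eq]
  linarith [(abs_lt.1 h).1]

theorem parityProb_lt_one (h0 : 0 < f) (h1 : f < 1) {K : ℕ} (hK : K ≠ 0) : parityProb f K < 1 := by
  have hb : |bias f| < 1 := by
    rw [bias, abs_lt]
    constructor <;> linarith
  have h : |bias f ^ K| < 1 := by
    rw [abs_pow]
    exact pow_lt_one₀ (abs_nonneg _) hb hK
  rw [parityProb_eq]
  linarith [(abs_lt.1 h).2]

/-- Chain rule: the entropy of `K` labels is that of their parity plus the average entropy given the
parity. -/
theorem mul_labelEntropy_eq (h0 : 0 < f) (h1 : f < 1) {K : ℕ} (hK : K ≠ 0) :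
    K * labelEntropy f = parityProb f K * (evenEntropy f K - Real.logb 2 (parityProb f K)) +
      (1 - parityProb f K) * (oddEntropy f K - Real.logb 2 (1 - parityProb f K)) := by
  have hp := (parityProb_pos h0 h1 hK).ne'
  have hq : 1 - parityProb f K ≠ 0 := (sub_pos.2 (parityProb_lt_one h0 h1 hK)).ne'
  rw [evenEntropy, oddEntropy, add_sub_cancel_right, add_sub_cancel_right, mul_div_cancel₀ _ hp,
    mul_div_cancel₀ _ hq]
  ring

/-- Given amplitude bit one, the two labels `(0, 1)` and `(1, 1)` are equally likely. -/
theorem oddEntropy_one (h1 : f < 1) : oddEntropy f 1 = 1 := by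
  have hq : 1 - parityProb f 1 = 2 * ((1 - f) / 3) := by
    rw [parityProb_eq, bias]
    ring
  have hpos : 0 < (1 - f) / 3 := by linarith
  have hb : (labelEntropy f - signedEntropy f) / 2 =
      2 * ((1 - f) / 3) * -Real.logb 2 ((1 - f) / 3) := by
    simp [labelEntropy, signedEntropy, sum_label, labelWeight, ampSign]
    ring
  rw [oddEntropy, hq, Real.logb_mul two_ne_zero hpos.ne']
  simp only [Nat.cast_one, one_mul, Nat.sub_self, pow_zero, hb]
  rw [mul_div_cancel_left₀ _ (by positivity), Real.logb_self_eq_one one_lt_two]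
  ring

/-- In an odd block of `2 * K` pairs either half is the odd one with equal probability, which costs
one bit; given this, the halves are independent. The proof checks it on the closed forms, using 1 −
p_{2K} = 2 p_K (1 − p_K). -/
theorem oddEntropy_two_mul (h0 : 0 < f) (h1 : f < 1) {K : ℕ} (hK : K ≠ 0) :
    oddEntropy f (2 * K) = 1 + evenEntropy f K + oddEntropy f K := by
  obtain ⟨k, rfl⟩ : ∃ k, K = k + 1 := ⟨K - 1, by omega⟩
  have hp := (parityProb_pos h0 h1 hK).ne'
  have hq : 1 - parityProb f (k + 1) ≠ 0 := (sub_pos.2 (parityProb_lt_one h0 h1 hK)).ne'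
  have hpq : 1 - parityProb f (2 * (k + 1)) =
      2 * (parityProb f (k + 1) * (1 - parityProb f (k + 1))) := by
    rw [parityProb_eq, parityProb_eq]
    ring
  rw [oddEntropy, evenEntropy, oddEntropy, hpq, Real.logb_mul two_ne_zero (mul_ne_zero hp hq),
    Real.logb_mul hp hq, Real.logb_self_eq_one one_lt_two]
  have hd : parityProb f (k + 1) = (1 + bias f ^ k * bias f) / 2 := by
    rw [parityProb_eq, pow_succ]
  have hpow : bias f ^ (2 * (k + 1) - 1) = bias f ^ k * (bias f ^ k * bias f) := by
    rw [← pow_succ, ← pow_add]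
    congr 1
    omega
  rw [hpow, Nat.add_sub_cancel]
  have key : ((2 * (k + 1) : ℕ) * labelEntropy f -
      (2 * (k + 1) : ℕ) * (bias f ^ k * (bias f ^ k * bias f)) * signedEntropy f) / 2 =
      2 * ((((k + 1 : ℕ) : ℝ) * labelEntropy f + (k + 1 : ℕ) * bias f ^ k * signedEntropy f) / 2 *
        (1 - parityProb f (k + 1)) + parityProb f (k + 1) *
        ((((k + 1 : ℕ) : ℝ) * labelEntropy f - (k + 1 : ℕ) * bias f ^ k * signedEntropy f) / 2)) := by
    rw [hd]
    push_cast
    ring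
  rw [key]
  field_simp
  ring

theorem oddEntropy_two_pow (h0 : 0 < f) (h1 : f < 1) (n : ℕ) :
    oddEntropy f (2 ^ n) = n + 1 + ∑ j ∈ range n, evenEntropy f (2 ^ j) := by
  induction n with
  | zero => simpa using oddEntropy_one h1
  | succ n ih =>
    rw [pow_succ', oddEntropy_two_mul h0 h1 (by positivity), ih, sum_range_succ]
    push_cast
    ring

/-! ### The entropy of the phase bit of the measured pair -/

/-- All phase bits are flipped. -/
def phaseFlip {ι : Type*} (x : ι → Label) : ι → Label := fun i => ((x i).1 + 1, (x i).2)

/-- Even parity recovers the last amplitude bit, and the shifted phases determine all phases once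
the last one is chosen. So each fibre has at most two strings, and passing to the shifted string
loses at most one bit. -/
theorem eq_or_eq_phaseFlip {m : ℕ} {x y : Fin (m + 1) → Label} (h : shifted y = shifted x)
    (hx : ∑ i, (x i).2 = 0) (hy : ∑ i, (y i).2 = 0) : y = x ∨ y = phaseFlip x := by
  have h2 : ∀ i : Fin m, (y i.castSucc).2 = (x i.castSucc).2 := fun i => by
    have := congrArg Prod.snd (congrFun h i)
    exact this
  have h1 : ∀ i : Fin m, (y i.castSucc).1 + (y (Fin.last m)).1 =
      (x i.castSucc).1 + (x (Fin.last m)).1 := fun i => by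
    have := congrArg Prod.fst (congrFun h i)
    exact this
  have hb : ∀ i, (y i).2 = (x i).2 := by
    refine Fin.lastCases ?_ h2
    rw [Fin.sum_univ_castSucc] at hx hy
    simp only [h2] at hy
    exact add_left_cancel (hy.trans hx.symm)
  have key1 : ∀ a b c : ZMod 2, a + b = c + b → a = c := by decide
  have key2 : ∀ a b c d : ZMod 2, b ≠ d → a + b = c + d → a = c + 1 := by decide
  have key3 : ∀ b d : ZMod 2, b ≠ d → b = d + 1 := by decide
  by_cases hl : (y (Fin.last m)).1 = (x (Fin.last m)).1
  · refine Or.inl (funext fun i => Prod.ext ?_ (hb i))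
    refine Fin.lastCases hl (fun i => ?_) i
    have := h1 i
    rw [hl] at this
    exact key1 _ _ _ this
  · refine Or.inr (funext fun i => Prod.ext ?_ (hb i))
    refine Fin.lastCases (key3 _ _ hl) (fun i => ?_) i
    exact key2 _ _ _ _ hl (h1 i)

/-- With s² = v/u, log (1 + s²) ≤ 2 log (1 + s) ≤ 2 s. The geometric mean is chosen as bound because
it factors over the pairs when `u` and `v` are product weights. -/
theorem mul_log_add_sub_log_le {u v : ℝ} (hu : 0 < u) (hv : 0 ≤ v) :
    u * (Real.log (u + v) - Real.log u) ≤ 2 * Real.sqrt (u * v) := by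
  set s := Real.sqrt (v / u) with hs
  have hs0 : 0 ≤ s := Real.sqrt_nonneg _
  have hs2 : s ^ 2 = v / u := Real.sq_sqrt (by positivity)
  have h1 : Real.sqrt (u * v) = u * s := by
    rw [show u * v = u ^ 2 * (v / u) by field_simp, Real.sqrt_mul (by positivity),
      Real.sqrt_sq hu.le]
  have h2 : Real.log (u + v) - Real.log u = Real.log (1 + s ^ 2) := by
    rw [← Real.log_div (by positivity) hu.ne', hs2]
    congr 1
    field_simp
  have h3 : Real.log (1 + s ^ 2) ≤ 2 * s := by
    calc Real.log (1 + s ^ 2) ≤ Real.log ((1 + s) ^ 2) :=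
          Real.log_le_log (by positivity) (by nlinarith)
      _ = 2 * Real.log (1 + s) := by rw [Real.log_pow]; norm_num
      _ ≤ 2 * s := by linarith [Real.log_le_sub_one_of_pos (show 0 < 1 + s by positivity)]
  rw [h1, h2]
  nlinarith

/-- The Bhattacharyya coefficient of the label distribution and its image under a phase flip. -/
noncomputable def phaseOverlap (f : ℝ) : ℝ :=
  2 * Real.sqrt (f * ((1 - f) / 3)) + 2 * ((1 - f) / 3)

theorem sum_sqrt_phaseFlip (h0 : 0 < f) (h1 : f < 1) (K : ℕ) :
    ∑ x : Fin K → Label, Real.sqrt (wernerWeight f x * wernerWeight f (phaseFlip x)) =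
      phaseOverlap f ^ K := by
  have hx : ∀ x : Fin K → Label, Real.sqrt (wernerWeight f x * wernerWeight f (phaseFlip x)) =
      ∏ i, Real.sqrt (labelWeight f (x i) * labelWeight f ((x i).1 + 1, (x i).2)) := by
    intro x
    have hW : ∀ y : Fin K → Label, wernerWeight f y = ∏ i, labelWeight f (y i) := fun _ => rfl
    rw [hW, hW, ← prod_mul_distrib, Real.sqrt_prod _ fun i _ =>
      (mul_pos (labelWeight_pos h0 h1 _) (labelWeight_pos h0 h1 _)).le]
    rfl
  have hG : 0 ≤ (1 - f) / 3 := by linarith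
  have e11 : (1 + 1 : ZMod 2) = 0 := rfl
  simp only [hx]
  rw [← Fintype.sum_pow fun c : Label =>
    Real.sqrt (labelWeight f c * labelWeight f (c.1 + 1, c.2)), sum_label, phaseOverlap]
  congr 1
  simp [labelWeight, e11, Real.sqrt_mul_self hG, mul_comm ((1 - f) / 3) f]
  ring

/-- The entropy of the phase bit of the last pair of a block given the shifted string, for even
parity. -/
noncomputable def phaseEntropy (f : ℝ) (K : ℕ) : ℝ := evenEntropy f K - S f (K - 1)

/-- Both entropies are conditioned on even parity, so the normalizations cancel and only the ratio
of the fibre's weight to the string's weight is left. -/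
theorem parityProb_mul_phaseEntropy (h0 : 0 < f) (h1 : f < 1) (m : ℕ) :
    parityProb f (m + 1) * phaseEntropy f (m + 1) =
      ∑ x : Fin (m + 1) → Label, if ∑ i, (x i).2 = 0 then
        wernerWeight f x * (Real.log (shiftedWeight f (shifted x)) - Real.log (wernerWeight f x)) /
          Real.log 2 else 0 := by
  classical
  have hp := parityProb_pos h0 h1 (Nat.succ_ne_zero m)
  have hw : ∀ x : Fin (m + 1) → Label, 0 ≤ wernerWeight f x :=
    prodWeight_nonneg (labelWeight_nonneg h0.le h1.le)
  have hpeq : parityProb f (m + 1) = ∑ x : Fin (m + 1) → Label,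
      if ∑ i, (x i).2 = 0 then wernerWeight f x else 0 := by
    simp [parityProb, stringWeight_werner_eq]
  rw [phaseEntropy, Nat.add_sub_cancel, mul_sub, parityProb_mul_S h0.le h1.le, evenEntropy,
    ← sum_even_mul_log h0 h1, mul_add, mul_div_cancel₀ _ hp.ne']
  nth_rewrite 1 [hpeq]
  rw [sum_mul, ← sum_add_distrib, ← sum_sub_distrib]
  refine sum_congr rfl fun x _ => ?_
  by_cases hx : ∑ i, (x i).2 = 0
  · have hxw : 0 < wernerWeight f x := prod_pos fun i _ => labelWeight_pos h0 h1 _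
    have hq : 0 < shiftedWeight f (shifted x) := mass_pos hw (x := x) ⟨rfl, hx⟩ hxw
    simp only [hx, if_true, Real.logb]
    rw [Real.log_div hq.ne' hp.ne']
    ring
  · simp [hx]

theorem phaseEntropy_nonneg (h0 : 0 < f) (h1 : f < 1) (m : ℕ) : 0 ≤ phaseEntropy f (m + 1) := by
  have hp := parityProb_pos h0 h1 (Nat.succ_ne_zero m)
  refine nonneg_of_mul_nonneg_right ?_ hp
  rw [parityProb_mul_phaseEntropy h0 h1]
  refine sum_nonneg fun x _ => ?_
  split_ifs with hx
  · have hw : ∀ x : Fin (m + 1) → Label, 0 ≤ wernerWeight f x :=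
      prodWeight_nonneg (labelWeight_nonneg h0.le h1.le)
    have hxw : 0 < wernerWeight f x := prod_pos fun i _ => labelWeight_pos h0 h1 _
    have hle : wernerWeight f x ≤ shiftedWeight f (shifted x) := by
      refine le_trans (le_of_eq ?_) (single_le_sum
        (fun y _ => Set.indicator_nonneg (fun z _ => hw z) y) (mem_univ x))
      rw [Set.indicator_of_mem]
      exact ⟨rfl, hx⟩
    exact div_nonneg (mul_nonneg hxw.le (sub_nonneg.2 (Real.log_le_log hxw hle)))
      (Real.log_nonneg one_le_two)
  · exact le_rfl

theorem parityProb_mul_phaseEntropy_le (h0 : 0 < f) (h1 : f < 1) (m : ℕ) :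
    parityProb f (m + 1) * phaseEntropy f (m + 1) ≤
      2 / Real.log 2 * phaseOverlap f ^ (m + 1) := by
  classical
  rw [parityProb_mul_phaseEntropy h0 h1, ← sum_sqrt_phaseFlip h0 h1, mul_sum]
  have hlog : 0 < Real.log 2 := Real.log_pos one_lt_two
  refine sum_le_sum fun x _ => ?_
  have hw : ∀ x : Fin (m + 1) → Label, 0 ≤ wernerWeight f x :=
    prodWeight_nonneg (labelWeight_nonneg h0.le h1.le)
  split_ifs with hx
  · have hxw : 0 < wernerWeight f x := prod_pos fun i _ => labelWeight_pos h0 h1 _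
    have hq : 0 < shiftedWeight f (shifted x) := mass_pos hw (x := x) ⟨rfl, hx⟩ hxw
    have hle : shiftedWeight f (shifted x) ≤ wernerWeight f x + wernerWeight f (phaseFlip x) := by
      refine (mass_mono hw (E' := {x} ∪ {phaseFlip x}) fun y hy => ?_).trans
        ((mass_union_le hw _ _).trans_eq ?_)
      · exact eq_or_eq_phaseFlip hy.1 hx hy.2
      · simp [mass, Set.indicator_apply]
    have h2 := mul_log_add_sub_log_le hxw (hw (phaseFlip x))
    have h3 : wernerWeight f x * (Real.log (shiftedWeight f (shifted x)) -
        Real.log (wernerWeight f x)) ≤ 2 * Real.sqrt (wernerWeight f x *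
          wernerWeight f (phaseFlip x)) :=
      le_trans (mul_le_mul_of_nonneg_left (sub_le_sub_right (Real.log_le_log hq hle) _) hxw.le) h2
    rw [div_mul_eq_mul_div]
    exact div_le_div_of_nonneg_right h3 hlog.le
  · positivity

theorem S_zero (h0 : 0 < f) (h1 : f < 1) : S f 0 = 0 := by
  have hp := (parityProb_pos h0 h1 one_ne_zero).ne'
  have hq : ∀ v : Fin 0 → Label, shiftedWeight f v = parityProb f (0 + 1) := by
    intro v
    rw [shiftedWeight, parityProb_eq_mass]
    congr 1
    ext x
    simp [eq_iff_true_of_subsingleton]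
  rw [S_eq]
  simp [shannon, hq, hp]

/-- The gain of `AEPP(a, N)` over universal hashing, per block. -/
theorem two_pow_mul_yield_sub (h0 : 0 < f) (h1 : f < 1) {n : ℕ} (hn : 1 ≤ n) :
    (2 : ℝ) ^ n * (protocolYield (aepp n) (werner f) -
        (1 - shannon ![f, (1 - f) / 3, (1 - f) / 3, (1 - f) / 3])) =
      shannon ![parityProb f (2 ^ n), 1 - parityProb f (2 ^ n)] - parityProb f (2 ^ n) +
        (parityProb f (2 ^ n) * phaseEntropy f (2 ^ n) +
          (1 - parityProb f (2 ^ n)) * ∑ j ∈ range n, phaseEntropy f (2 ^ j)) := by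
  -- The entropy of the whole block, with the odd part unrolled along the halvings; subtracting the
  -- yield formula leaves only differences between `evenEntropy` and `S`.
  have hH := mul_labelEntropy_eq h0 h1 (K := 2 ^ n) (by positivity)
  rw [oddEntropy_two_pow h0 h1] at hH
  push_cast at hH
  -- The unrolling runs down to blocks of one pair, the yield formula only to two; the extra term is
  -- `S f 0 = 0`.
  have hsum : ∑ j ∈ range n, S f (2 ^ j - 1) = ∑ j ∈ Ico 1 n, S f (2 ^ j - 1) := by
    rw [range_eq_Ico, sum_eq_sum_Ico_succ_bot hn]
    simp [S_zero h0 h1]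
  have hsh : shannon ![parityProb f (2 ^ n), 1 - parityProb f (2 ^ n)] =
      -(parityProb f (2 ^ n) * Real.logb 2 (parityProb f (2 ^ n)) +
        (1 - parityProb f (2 ^ n)) * Real.logb 2 (1 - parityProb f (2 ^ n))) := by
    simp [shannon, Fin.sum_univ_two]
  rw [(yield_aepp h0.le h1.le hn).2, shannon_werner, hsh]
  simp only [phaseEntropy, sum_sub_distrib, hsum]
  rw [← labelEntropy]
  have hN : (2 : ℝ) ^ n ≠ 0 := by positivity
  have e : (2 : ℝ) ^ n * (1 - parityProb f (2 ^ n) / (2 : ℝ) ^ n * (1 + S f (2 ^ n - 1))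
          - (1 - parityProb f (2 ^ n)) / (2 : ℝ) ^ n *
              ((n : ℝ) + 1 + ∑ k ∈ Ico 1 n, S f (2 ^ k - 1)) - (1 - labelEntropy f)) =
      (2 : ℝ) ^ n * labelEntropy f - parityProb f (2 ^ n) * (1 + S f (2 ^ n - 1))
          - (1 - parityProb f (2 ^ n)) *
              ((n : ℝ) + 1 + ∑ k ∈ Ico 1 n, S f (2 ^ k - 1)) := by
    field_simp
    ring
  rw [e, hH]
  ring

end

/-! ### Fidelity `(2^n - 1) / 2^n` -/

section

theorem shannon_pair (p : ℝ) : shannon ![p, 1 - p] = Real.binEntropy p / Real.log 2 := by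
  simp [shannon, Fin.sum_univ_two, Real.binEntropy, Real.logb, Real.log_inv]
  ring

/-- From log x ≤ x − 1 the entropy is at least 2 p (1−p) / log 2, so 2 (1−p) > log 2 suffices. With
p < 0.65 this reads 0.7 > 0.6932. -/
theorem lt_shannon_pair {p : ℝ} (hp : p = (1 + Real.exp (-(4 / 3))) / 2) :
    p < shannon ![p, 1 - p] := by
  have hlog : 0 < Real.log 2 := Real.log_pos one_lt_two
  -- Uses exp (4/3) = e · exp (1/3) ≥ e · 4/3 > 10/3.
  have h1 : Real.exp (-(4 / 3)) < 0.3 := by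
    rw [Real.exp_neg, inv_lt_comm₀ (Real.exp_pos _) (by norm_num)]
    have e1 : Real.exp (4 / 3) = Real.exp 1 * Real.exp (1 / 3) := by
      rw [← Real.exp_add]; norm_num
    have e2 := Real.exp_one_gt_d9
    have e3 := Real.add_one_le_exp (1 / 3 : ℝ)
    rw [e1]
    nlinarith
  have h0 := Real.exp_pos (-(4 / 3))
  have hp0 : 0 < p := by rw [hp]; positivity
  have hp1 : p < 0.65 := by rw [hp]; linarith
  have a1 := Real.log_le_sub_one_of_pos hp0
  have a2 := Real.log_le_sub_one_of_pos (show 0 < 1 - p by linarith)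
  have hlog2 := Real.log_two_lt_d9
  rw [shannon_pair, lt_div_iff₀ hlog, Real.binEntropy, Real.log_inv, Real.log_inv]
  nlinarith [mul_le_mul_of_nonneg_left a1 hp0.le,
    mul_le_mul_of_nonneg_left a2 (show 0 ≤ 1 - p by linarith)]

/-- The fidelity `(2^n - 1) / 2^n`. -/
noncomputable def fidelity (n : ℕ) : ℝ := ((2 : ℝ) ^ n - 1) / (2 : ℝ) ^ n

theorem fidelity_eq (n : ℕ) : fidelity n = 1 - 1 / 2 ^ n := by
  rw [fidelity]
  field_simp

theorem fidelity_nonneg (n : ℕ) : 0 ≤ fidelity n :=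
  div_nonneg (sub_nonneg.2 (one_le_pow₀ one_le_two)) (by positivity)

theorem fidelity_lt_one (n : ℕ) : fidelity n < 1 := by
  rw [fidelity_eq]
  have : (0 : ℝ) < 1 / 2 ^ n := by positivity
  linarith

theorem half_le_fidelity {n : ℕ} (hn : 1 ≤ n) : 1 / 2 ≤ fidelity n := by
  rw [fidelity_eq]
  have h2 : (2 : ℝ) ^ 1 ≤ 2 ^ n := pow_le_pow_right₀ one_le_two hn
  have : (1 : ℝ) / 2 ^ n ≤ 1 / 2 := by
    rw [pow_one] at h2
    exact one_div_le_one_div_of_le two_pos h2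
  linarith

theorem bias_fidelity (n : ℕ) : bias (fidelity n) = 1 - 4 / 3 / (2 ^ n : ℕ) := by
  rw [bias, fidelity_eq]
  push_cast
  ring

theorem tendsto_parityProb : Tendsto (fun n => parityProb (fidelity n) (2 ^ n)) atTop
    (𝓝 ((1 + Real.exp (-(4 / 3))) / 2)) := by
  have h1 := (Real.tendsto_one_add_div_pow_exp (-(4 / 3))).comp
    (tendsto_pow_atTop_atTop_of_one_lt (one_lt_two (α := ℕ)))
  have h2 := (h1.const_add 1).div_const 2
  refine h2.congr fun n => ?_
  rw [parityProb_eq, bias_fidelity]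
  simp only [Function.comp_apply]
  congr 3
  ring

/-- By (1 − t/N)^N ≤ exp (−t) the limit bounds the parity probability from above, the direction
needed for a decreasing gain. -/
theorem parityProb_fidelity_le {n : ℕ} (hn : 1 ≤ n) :
    parityProb (fidelity n) (2 ^ n) ≤ (1 + Real.exp (-(4 / 3))) / 2 := by
  have h2 : (2 : ℝ) ^ 1 ≤ 2 ^ n := pow_le_pow_right₀ one_le_two hn
  have := Real.one_sub_div_pow_le_exp_neg (n := 2 ^ n) (t := 4 / 3) (by push_cast; linarith)
  rw [parityProb_eq, bias_fidelity]
  linarith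

theorem half_le_parityProb {n : ℕ} (hn : 1 ≤ n) (K : ℕ) :
    1 / 2 ≤ parityProb (fidelity n) K := by
  have hb : 0 ≤ bias (fidelity n) := by
    rw [bias]
    linarith [half_le_fidelity hn]
  rw [parityProb_eq]
  linarith [pow_nonneg hb K]

theorem shannon_pair_sub_antitone {p q : ℝ} (hp : 1 / 2 ≤ p) (hpq : p ≤ q) (hq : q ≤ 1) :
    shannon ![q, 1 - q] - q ≤ shannon ![p, 1 - p] - p := by
  rw [shannon_pair, shannon_pair]
  have h := Real.binEntropy_strictAntiOn.antitoneOn (a := p) (b := q)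
    ⟨by linarith, by linarith⟩ ⟨by linarith, hq⟩ hpq
  have := div_le_div_of_nonneg_right h (Real.log_pos one_lt_two).le
  linarith

/-- The entropy of the phase bits that are not set aside. -/
noncomputable def phaseExcess (n : ℕ) : ℝ :=
  parityProb (fidelity n) (2 ^ n) * phaseEntropy (fidelity n) (2 ^ n) +
    (1 - parityProb (fidelity n) (2 ^ n)) * ∑ j ∈ range n, phaseEntropy (fidelity n) (2 ^ j)

theorem phaseEntropy_two_pow_nonneg {f : ℝ} (h0 : 0 < f) (h1 : f < 1) (j : ℕ) :
    0 ≤ phaseEntropy f (2 ^ j) := by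
  have := phaseEntropy_nonneg h0 h1 (2 ^ j - 1)
  rwa [Nat.sub_add_cancel Nat.one_le_two_pow] at this

theorem phaseExcess_nonneg {n : ℕ} (hn : 1 ≤ n) : 0 ≤ phaseExcess n := by
  have h0 : 0 < fidelity n := by linarith [half_le_fidelity hn]
  have h1 := fidelity_lt_one n
  have hp := parityProb_pos h0 h1 (K := 2 ^ n) (by positivity)
  have hq := parityProb_lt_one h0 h1 (K := 2 ^ n) (by positivity)
  exact add_nonneg (mul_nonneg hp.le (phaseEntropy_two_pow_nonneg h0 h1 n))
    (mul_nonneg (sub_nonneg.2 hq.le) (sum_nonneg fun j _ => phaseEntropy_two_pow_nonneg h0 h1 j))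

/-- Division by the parity probability, at least 1/2 here, doubles the constant. -/
theorem phaseEntropy_fidelity_le {n : ℕ} (hn : 1 ≤ n) (j : ℕ) :
    phaseEntropy (fidelity n) (2 ^ j) ≤
      4 / Real.log 2 * phaseOverlap (fidelity n) ^ (2 ^ j) := by
  have h0 : 0 < fidelity n := by linarith [half_le_fidelity hn]
  have h1 := fidelity_lt_one n
  have h := parityProb_mul_phaseEntropy_le h0 h1 (2 ^ j - 1)
  rw [Nat.sub_add_cancel Nat.one_le_two_pow] at h
  have hp := half_le_parityProb hn (2 ^ j)
  have hnn := phaseEntropy_two_pow_nonneg h0 h1 j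
  have e : 4 / Real.log 2 * phaseOverlap (fidelity n) ^ (2 ^ j) =
      2 * (2 / Real.log 2 * phaseOverlap (fidelity n) ^ (2 ^ j)) := by ring
  rw [e]
  nlinarith [mul_le_mul_of_nonneg_right hp hnn]

theorem phaseOverlap_nonneg {f : ℝ} (h1 : f ≤ 1) : 0 ≤ phaseOverlap f := by
  have : 0 ≤ (1 - f) / 3 := by linarith
  unfold phaseOverlap
  positivity

theorem phaseOverlap_fidelity_sq_le (n : ℕ) : phaseOverlap (fidelity n) ^ 2 ≤ 16 / 2 ^ n := by
  have h1 := (fidelity_lt_one n).le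
  have h0 := fidelity_nonneg n
  set G := (1 - fidelity n) / 3 with hG
  have hG0 : 0 ≤ G := by rw [hG]; linarith
  have hG1 : G ≤ 1 := by rw [hG]; linarith
  have hGle : G ≤ 1 / 2 ^ n := by
    rw [hG, fidelity_eq]
    have : (0 : ℝ) < 1 / 2 ^ n := by positivity
    linarith
  have hs := Real.sq_sqrt (mul_nonneg h0 hG0)
  have hs0 := Real.sqrt_nonneg (fidelity n * G)
  -- With s² = F G ≤ G and G² ≤ G, (2s + 2G)² ≤ 8 (s² + G²) ≤ 16 G.
  have hle : phaseOverlap (fidelity n) ^ 2 ≤ 16 * G := by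
    rw [phaseOverlap, ← hG]
    nlinarith [sq_nonneg (Real.sqrt (fidelity n * G) - G), mul_le_mul_of_nonneg_right h1 hG0,
      mul_le_mul_of_nonneg_right hG1 hG0]
  calc _ ≤ 16 * G := hle
    _ ≤ 16 * (1 / 2 ^ n) := by linarith
    _ = _ := by ring

/-- The whole block and the one-pair term give at most one overlap each; every other block has at
least two pairs and gives at most its square. -/
theorem phaseExcess_le {n : ℕ} (hn : 1 ≤ n) (hr : phaseOverlap (fidelity n) ≤ 1) :
    phaseExcess n ≤ 4 / Real.log 2 *
      (2 * phaseOverlap (fidelity n) + n * phaseOverlap (fidelity n) ^ 2) := by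
  have h0 : 0 < fidelity n := by linarith [half_le_fidelity hn]
  have h1 := fidelity_lt_one n
  have hp := parityProb_pos h0 h1 (K := 2 ^ n) (by positivity)
  have hq := parityProb_lt_one h0 h1 (K := 2 ^ n) (by positivity)
  have hr0 := phaseOverlap_nonneg h1.le
  have hlog : 0 < Real.log 2 := Real.log_pos one_lt_two
  set r := phaseOverlap (fidelity n) with hrdef
  set C := 4 / Real.log 2 with hC
  have hC0 : 0 ≤ C := by positivity
  have hD : ∀ j, phaseEntropy (fidelity n) (2 ^ j) ≤ C * r ^ (2 ^ j) :=
    phaseEntropy_fidelity_le hn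
  have hD0 := phaseEntropy_two_pow_nonneg h0 h1
  have b1 : parityProb (fidelity n) (2 ^ n) * phaseEntropy (fidelity n) (2 ^ n) ≤ C * r :=
    calc _ ≤ 1 * phaseEntropy (fidelity n) (2 ^ n) := mul_le_mul_of_nonneg_right hq.le (hD0 n)
      _ ≤ C * r ^ (2 ^ n) := by rw [one_mul]; exact hD n
      _ ≤ C * r := mul_le_mul_of_nonneg_left
          (pow_le_of_le_one hr0 hr (by positivity)) hC0
  have b2 : ∑ j ∈ range n, phaseEntropy (fidelity n) (2 ^ j) ≤ C * r + n * (C * r ^ 2) := by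
    obtain ⟨m, rfl⟩ : ∃ m, n = m + 1 := ⟨n - 1, by omega⟩
    rw [sum_range_succ']
    have b3 : ∑ j ∈ range m, phaseEntropy (fidelity (m + 1)) (2 ^ (j + 1)) ≤ m * (C * r ^ 2) := by
      refine (sum_le_card_nsmul _ _ (C * r ^ 2) fun j _ => (hD (j + 1)).trans ?_).trans_eq ?_
      · refine mul_le_mul_of_nonneg_left (pow_le_pow_of_le_one hr0 hr ?_) hC0
        rw [pow_succ]
        have := Nat.one_le_two_pow (n := j)
        omega
      · simp
    have b4 := hD 0
    rw [pow_zero, pow_one] at b4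
    rw [pow_zero]
    push_cast
    nlinarith [mul_nonneg hC0 (sq_nonneg r)]
  have b5 : (1 - parityProb (fidelity n) (2 ^ n)) *
      ∑ j ∈ range n, phaseEntropy (fidelity n) (2 ^ j) ≤ C * r + n * (C * r ^ 2) := by
    refine le_trans ?_ b2
    exact mul_le_of_le_one_left (sum_nonneg fun j _ => hD0 j) (by linarith)
  rw [phaseExcess]
  calc _ ≤ C * r + (C * r + n * (C * r ^ 2)) := add_le_add b1 b5
    _ = _ := by ring

theorem tendsto_phaseOverlap : Tendsto (fun n => phaseOverlap (fidelity n)) atTop (𝓝 0) := by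
  have h : Tendsto (fun n : ℕ => (16 : ℝ) / 2 ^ n) atTop (𝓝 0) :=
    tendsto_const_nhds.div_atTop (tendsto_pow_atTop_atTop_of_one_lt one_lt_two)
  have h2 := (Real.continuous_sqrt.tendsto 0).comp h
  rw [Real.sqrt_zero] at h2
  refine squeeze_zero (fun n => phaseOverlap_nonneg (fidelity_lt_one n).le) (fun n => ?_) h2
  exact Real.le_sqrt_of_sq_le (phaseOverlap_fidelity_sq_le n)

theorem tendsto_phaseExcess : Tendsto phaseExcess atTop (𝓝 0) := by
  have hn : Tendsto (fun n : ℕ => (n : ℝ) * phaseOverlap (fidelity n) ^ 2) atTop (𝓝 0) := by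
    have h := (tendsto_pow_const_div_const_pow_of_one_lt 1 (one_lt_two (α := ℝ))).const_mul 16
    rw [mul_zero] at h
    refine squeeze_zero (fun n => by positivity) (fun n => ?_) h
    calc (n : ℝ) * phaseOverlap (fidelity n) ^ 2 ≤ n * (16 / 2 ^ n) :=
          mul_le_mul_of_nonneg_left (phaseOverlap_fidelity_sq_le n) (Nat.cast_nonneg n)
      _ = 16 * ((n : ℝ) ^ 1 / 2 ^ n) := by ring
  have hb := ((tendsto_phaseOverlap.const_mul 2).add hn).const_mul (4 / Real.log 2)
  simp only [mul_zero, add_zero] at hb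
  refine tendsto_of_tendsto_of_tendsto_of_le_of_le' tendsto_const_nhds hb ?_ ?_
  · filter_upwards [eventually_ge_atTop 1] with n h1 using phaseExcess_nonneg h1
  · filter_upwards [eventually_ge_atTop 1,
      tendsto_phaseOverlap.eventually_le_const zero_lt_one] with n h1 h2
    exact phaseExcess_le h1 h2

theorem two_pow_mul_yield_sub_fidelity {n : ℕ} (hn : 1 ≤ n) :
    (2 : ℝ) ^ n * (protocolYield (aepp n) (werner (fidelity n)) -
        (1 - shannon ![fidelity n, (1 - fidelity n) / 3, (1 - fidelity n) / 3,
          (1 - fidelity n) / 3])) =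
      shannon ![parityProb (fidelity n) (2 ^ n), 1 - parityProb (fidelity n) (2 ^ n)] -
        parityProb (fidelity n) (2 ^ n) + phaseExcess n :=
  two_pow_mul_yield_sub (by linarith [half_le_fidelity hn]) (fidelity_lt_one n) hn

theorem tendsto_two_pow_mul_yield_sub {p : ℝ} (hp : p = (1 + Real.exp (-(4 / 3))) / 2) :
    Tendsto (fun n : ℕ => (2 : ℝ) ^ n * (protocolYield (aepp n) (werner (fidelity n)) -
        (1 - shannon ![fidelity n, (1 - fidelity n) / 3, (1 - fidelity n) / 3,
          (1 - fidelity n) / 3]))) atTop (𝓝 (shannon ![p, 1 - p] - p)) := by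
  have h1 : Tendsto (fun n => parityProb (fidelity n) (2 ^ n)) atTop (𝓝 p) :=
    hp ▸ tendsto_parityProb
  have h2 := (((Real.binEntropy_continuous.tendsto p).comp h1).div_const (Real.log 2)).sub h1
  have h3 := h2.add tendsto_phaseExcess
  rw [add_zero, ← shannon_pair] at h3
  refine h3.congr' ?_
  filter_upwards [eventually_ge_atTop 1] with n hn
  rw [two_pow_mul_yield_sub_fidelity hn, shannon_pair]
  rfl

/-- The parity probability lies in [1/2, p], where the main term is decreasing, and the phase excess
is nonnegative; hence the bound already holds from `n = 1`. -/
theorem le_two_pow_mul_yield_sub {p : ℝ} (hp : p = (1 + Real.exp (-(4 / 3))) / 2) {n : ℕ}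
    (hn : 1 ≤ n) :
    shannon ![p, 1 - p] - p ≤
      (2 : ℝ) ^ n * (protocolYield (aepp n) (werner (fidelity n)) -
        (1 - shannon ![fidelity n, (1 - fidelity n) / 3, (1 - fidelity n) / 3,
          (1 - fidelity n) / 3])) := by
  have h1 : Real.exp (-(4 / 3)) ≤ 1 := Real.exp_le_one_iff.2 (by norm_num)
  have := shannon_pair_sub_antitone (half_le_parityProb hn (2 ^ n))
    ((parityProb_fidelity_le hn).trans_eq hp.symm) (by rw [hp]; linarith)
  rw [two_pow_mul_yield_sub_fidelity hn]
  linarith [phaseExcess_nonneg hn]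

end

end Purification

/-! ### Assembly of the theorem -/

theorem mainTheorem1 (F G : ℕ → ℝ) (pStar : ℝ)
    (hF : ∀ n, F n = ((2 : ℝ) ^ n - 1) / (2 : ℝ) ^ n)
    (hG : ∀ n, G n = (1 - F n) / 3)
    (hpStar : pStar = (1 + Real.exp (-(4 / 3))) / 2) :
    -- the yield of AEPP(a, 2^n) on the Werner state with fidelity f
    (∀ n : ℕ, 1 ≤ n → ∀ f : ℝ, 0 ≤ f → f ≤ 1 →
      IsLUB (Purification.achievableRates (Purification.aepp n) (Purification.werner f))
        (Purification.protocolYield (Purification.aepp n) (Purification.werner f)) ∧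
      Purification.protocolYield (Purification.aepp n) (Purification.werner f) =
        1 - Purification.parityProb f (2 ^ n) / (2 : ℝ) ^ n *
              (1 + Purification.S f (2 ^ n - 1))
          - (1 - Purification.parityProb f (2 ^ n)) / (2 : ℝ) ^ n *
              ((n : ℝ) + 1 + ∑ k ∈ Finset.Ico 1 n, Purification.S f (2 ^ k - 1))) ∧
    -- the yield of universal hashing on the Werner state with fidelity f
    (∀ f : ℝ, 0 ≤ f → f ≤ 1 →
      IsLUB (Purification.achievableRates Purification.universalHashing (Purification.werner f))
        (Purification.protocolYield Purification.universalHashing (Purification.werner f)) ∧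
      Purification.protocolYield Purification.universalHashing (Purification.werner f) =
        1 - Purification.shannon ![f, (1 - f) / 3, (1 - f) / 3, (1 - f) / 3]) ∧
    -- the limit of the parity probability for fidelity (2^n - 1) / 2^n
    Filter.Tendsto (fun n => Purification.parityProb (F n) (2 ^ n)) Filter.atTop (nhds pStar) ∧
    -- the comparison for large n, and to first order in 1 / 2^n in the limit
    (∀ᶠ n : ℕ in Filter.atTop,
      Purification.protocolYield (Purification.aepp n) (Purification.werner (F n)) ≥
        1 - Purification.shannon ![F n, G n, G n, G n] +
          (Purification.shannon ![pStar, 1 - pStar] - pStar) / (2 : ℝ) ^ n) ∧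
    (∃ l : ℝ, l ≥ Purification.shannon ![pStar, 1 - pStar] - pStar ∧
      Filter.Tendsto (fun n : ℕ => (2 : ℝ) ^ n *
        (Purification.protocolYield (Purification.aepp n) (Purification.werner (F n)) -
          (1 - Purification.shannon ![F n, G n, G n, G n]))) Filter.atTop (nhds l)) ∧
    (∀ n : ℕ, 1 - Purification.shannon ![F n, G n, G n, G n] +
        (Purification.shannon ![pStar, 1 - pStar] - pStar) / (2 : ℝ) ^ n >
      1 - Purification.shannon ![F n, G n, G n, G n]) ∧
    (∀ n : ℕ, 1 - Purification.shannon ![F n, G n, G n, G n] =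
      Purification.protocolYield Purification.universalHashing (Purification.werner (F n))) := by
  obtain rfl : F = Purification.fidelity := funext hF
  obtain rfl : G = fun n => (1 - Purification.fidelity n) / 3 := funext hG
  have hgap := Purification.lt_shannon_pair hpStar
  refine ⟨fun n hn f h0 h1 => Purification.yield_aepp h0 h1 hn,
    fun f h0 h1 => Purification.yield_universalHashing h0 h1,
    hpStar ▸ Purification.tendsto_parityProb, ?_,
    -- The limit equals the claimed lower bound, since the phase excess tends to zero.
    ⟨_, le_rfl, Purification.tendsto_two_pow_mul_yield_sub hpStar⟩, fun n => ?_, fun n => ?_⟩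
  · filter_upwards [Filter.eventually_ge_atTop 1] with n hn
    have h := Purification.le_two_pow_mul_yield_sub hpStar hn
    rw [mul_comm, ← div_le_iff₀ (by positivity)] at h
    linarith
  · exact lt_add_of_pos_right _ (div_pos (sub_pos.2 hgap) (by positivity))
  · exact (Purification.yield_universalHashing (Purification.fidelity_nonneg n)
      (Purification.fidelity_lt_one n).le).2.symm
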